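/- **Theorem 2.3 (Upper bound).** Let $n\ge 1$, $p_1,p_2,r\ge 0$ be integers and $\sigma\ge 0$. Let $\beta^{(1)},\dots,\beta^{(n)}\in\mathbb{R}^{p_1}$ and $\gamma^{(1)},\dots,\gamma^{(n)}\in\mathbb{R}^{p_2}$ be random vectors all of whose entries are independent standard normal variables, and let the noise $z=(z_1,\dots,z_n)$ have i.i.d. $N(0,\sigma^2)$ coordinates and be independent of the $\beta^{(i)},\gamma^{(i)}$. Define the (rank-one projection, ROP) linear map $\mathcal{X}:\mathbb{R}^{p_1\times p_2}\to\mathbb{R}^n$ by $[\mathcal{X}(M)]_i=(\beta^{(i)})^\top M\gamma^{(i)}$, and its dual by $\mathcal{X}^*(w)=\sum_{i=1}^n w_i\,\beta^{(i)}(\gamma^{(i)})^\top$. Put $$\eta=\sigma\Bigl(12\sqrt{\log n}\,(p_1+p_2)+6\sqrt{2n(p_1+p_2)}\Bigr),$$ $$\mathcal{Z}_G=\bigl\{w\in\mathbb{R}^n:\ \|w\|_1/n\le\sigma\ \text{ and }\ \|\mathcal{X}^*(w)\|\le\eta\bigr\},$$ where $\|\cdot\|$ is the spectral norm. For $A\in\mathbb{R}^{p_1\times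 p_2}$ and the observation $y=\mathcal{X}(A)+z$, let $\hat A$ denote a minimizer of the nuclear norm $\|M\|_*$ over all $M\in\mathbb{R}^{p_1\times p_2}$ with $y-\mathcal{X}(M)\in\mathcal{Z}_G$. There exist universal constants $C,W,\delta>0$ (not depending on $n,p_1,p_2,r,\sigma$) such that, whenever $n\ge Cr(p_1+p_2)$, there is an event of probability at least $$1-\frac{11}{n}-3\exp\bigl(-\delta(p_1+p_2)\bigr)$$ on which, simultaneously for all matrices $A\in\mathbb{R}^{p_1\times p_2}$ of rank at most $r$, a minimizer $\hat A$ exists and every minimizer satisfies $$\|\hat A-A\|_F^2\le W\sigma^2\min\Bigl(\frac{r\log n\,(p_1+p_2)^2}{n^2}+\frac{r(p_1+p_2)}{n},\,1\Bigr).$$ -/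

import Mathlib

open MeasureTheory ProbabilityTheory Matrix
open scoped BigOperators NNReal

noncomputable section

namespace ROP

/-- The squared Frobenius norm `∑ᵢⱼ Mᵢⱼ²` of a real matrix. -/
def frobSq {p₁ p₂ : ℕ} (M : Matrix (Fin p₁) (Fin p₂) ℝ) : ℝ :=
  ∑ j, ∑ k, M j k ^ 2

/-- The nuclear norm: the sum of the singular values (with respect to the Euclidean norms).
Mathlib's `singularValues` lists them in decreasing order, padded by zeros. -/
def nuclearNorm {p₁ p₂ : ℕ} (M : Matrix (Fin p₁) (Fin p₂) ℝ) : ℝ :=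
  ∑ i : Fin p₂, (Matrix.toEuclideanLin M).singularValues i

/-- The spectral norm: the operator norm with respect to the Euclidean norms. -/
def spectralNorm {p₁ p₂ : ℕ} (M : Matrix (Fin p₁) (Fin p₂) ℝ) : ℝ :=
  ‖LinearMap.toContinuousLinearMap (Matrix.toEuclideanLin M)‖

/-- The linear map `𝒳 : ℝ^{p₁ × p₂} → ℝⁿ` of rank-one projections,
`[𝒳(M)]ᵢ = (β⁽ⁱ⁾)ᵀ M γ⁽ⁱ⁾`. -/
def ropMap {n p₁ p₂ : ℕ} (b : Fin n → Fin p₁ → ℝ) (g : Fin n → Fin p₂ → ℝ) :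
    Matrix (Fin p₁) (Fin p₂) ℝ →ₗ[ℝ] (Fin n → ℝ) where
  toFun M := fun i => b i ⬝ᵥ (M *ᵥ g i)
  map_add' M N := by
    funext i
    simp [Matrix.add_mulVec, dotProduct_add]
  map_smul' c M := by
    funext i
    simp [Matrix.smul_mulVec, dotProduct_smul]

/-- The dual operator `𝒳*(w) = ∑ᵢ wᵢ Xᵢ` with the measurement matrices
`Xᵢ = β⁽ⁱ⁾ (γ⁽ⁱ⁾)ᵀ`. -/
def ropDual {n p₁ p₂ : ℕ} (b : Fin n → Fin p₁ → ℝ) (g : Fin n → Fin p₂ → ℝ)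
    (w : Fin n → ℝ) : Matrix (Fin p₁) (Fin p₂) ℝ :=
  ∑ i, w i • Matrix.vecMulVec (b i) (g i)

/-- The level `η = σ (12 √(log n) (p₁ + p₂) + 6 √(2 n (p₁ + p₂)))`. -/
def eta (n p₁ p₂ : ℕ) (σ : ℝ) : ℝ :=
  σ * (12 * Real.sqrt (Real.log n) * ((p₁ : ℝ) + p₂)
    + 6 * Real.sqrt (2 * n * ((p₁ : ℝ) + p₂)))

/-- The `ℓ₁` constraint set `{w : ‖w‖₁ / n ≤ σ}`. -/
def constraintL1 (n : ℕ) (σ : ℝ) : Set (Fin n → ℝ) :=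
  {w | (∑ i, |w i|) / n ≤ σ}

/-- The Dantzig-type constraint set `{w : ‖𝒳*(w)‖ ≤ η}`. -/
def constraintDantzig {n p₁ p₂ : ℕ} (b : Fin n → Fin p₁ → ℝ) (g : Fin n → Fin p₂ → ℝ)
    (σ : ℝ) : Set (Fin n → ℝ) :=
  {w | spectralNorm (ropDual b g w) ≤ eta n p₁ p₂ σ}

/-- The matrices `M` that are feasible for the observation `y`: the residual `y - 𝒳(M)` lies in
both constraint sets. -/
def feasible {n p₁ p₂ : ℕ} (b : Fin n → Fin p₁ → ℝ) (g : Fin n → Fin p₂ → ℝ)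
    (σ : ℝ) (y : Fin n → ℝ) : Set (Matrix (Fin p₁) (Fin p₂) ℝ) :=
  {M | y - ropMap b g M ∈ constraintL1 n σ ∩ constraintDantzig b g σ}

/-- `Â` is a value of the estimator: a minimizer of the nuclear norm over the feasible set. -/
def IsEstimate {n p₁ p₂ : ℕ} (b : Fin n → Fin p₁ → ℝ) (g : Fin n → Fin p₂ → ℝ)
    (σ : ℝ) (y : Fin n → ℝ) (Ahat : Matrix (Fin p₁) (Fin p₂) ℝ) : Prop :=
  Ahat ∈ feasible b g σ y ∧ IsMinOn nuclearNorm (feasible b g σ y) Ahat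

/-- The family of all the scalar entries of the vectors `β⁽ⁱ⁾`, `γ⁽ⁱ⁾`. -/
def designEntries {Ω : Type*} {n p₁ p₂ : ℕ} (β : Ω → Fin n → Fin p₁ → ℝ)
    (γ : Ω → Fin n → Fin p₂ → ℝ) : (Fin n × Fin p₁) ⊕ (Fin n × Fin p₂) → Ω → ℝ :=
  Sum.elim (fun k ω => β ω k.1 k.2) (fun k ω => γ ω k.1 k.2)

/-- ROP design from a distribution `P`: all the entries of the `β⁽ⁱ⁾` and `γ⁽ⁱ⁾` are drawn
independently from `P`. -/
structure IsROPDesign {Ω : Type*} [MeasurableSpace Ω] (μ : Measure Ω) (P : Measure ℝ)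
    {n p₁ p₂ : ℕ} (β : Ω → Fin n → Fin p₁ → ℝ) (γ : Ω → Fin n → Fin p₂ → ℝ) : Prop where
  hasLaw : ∀ k, HasLaw (designEntries β γ k) P μ
  iIndep : iIndepFun (designEntries β γ) μ

/-- The coordinates of the noise vector are i.i.d. with law `N(0, σ²)`. -/
structure IsGaussianNoise {Ω : Type*} [MeasurableSpace Ω] (μ : Measure Ω) (σ : ℝ)
    {n : ℕ} (z : Ω → Fin n → ℝ) : Prop where
  hasLaw : ∀ i, HasLaw (fun ω => z ω i) (gaussianReal 0 (Real.toNNReal (σ ^ 2))) μ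
  iIndep : iIndepFun (fun i ω => z ω i) μ

end ROP

end

/-! Put `H = Ahat - A` and `F = ‖H‖_F`. If the noise is feasible then so is `A`, hence `‖A + H‖_* ≤
‖A‖_*`, and the low rank of `A` forces `H` into the cone `‖H‖_* ≤ 3 √r F`
(`nuclearNorm_le_of_nuclearNorm_add_le`). Suppose that on this cone `‖𝒳(H)‖₁ ≥ (n / 6) F`. The `ℓ₁`
constraint gives `‖𝒳(H)‖₁ ≤ 2 σ n`, so `F ≤ 12 σ`. The Dantzig constraint and duality give `‖𝒳(H)‖₂²
= ⟨𝒳*𝒳(H), H⟩ ≤ 2 η · 3 √r F`, and Cauchy–Schwarz turns this into `n F ≤ 216 √r η`. This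
deterministic part is `frobSq_sub_le_of_isEstimate`.

Two random events remain. For the lower bound on the cone (`sampleLaw_lower_bound_fails_le`), a unit
matrix has `E|βᵀ M γ| ≥ 1/3`. The uniform deviation from the mean is controlled through exponential
moments of suprema: symmetrization removes the absolute values and leaves a linear process in `H`,
which is at most `‖𝒳*(1)‖ · 3 √r` by duality. The design is itself symmetric under `β ↦ -β`, so no
auxiliary random signs are needed.

For feasibility of the noise (`sampleLaw_prod_noiseLaw_notMem_constraint_le`), scaling reduces to `σ
= 1`. The noise satisfies an `ℓ₁`, an `ℓ₂` and a sup bound outside probability `11 / n`. For such a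
fixed noise vector, a Chernoff bound in the design controls `‖𝒳*(w)‖`.

Both events rest on `lintegral_exp_spectralNorm_ropDual_le`, a net bound for the exponential moment
of `‖𝒳*(w)‖`. -/

noncomputable section

namespace ROP

/-! ### Nuclear and spectral norms: duality, pinching and the low-rank cone. -/

section LinearAlgebra

variable {m n : ℕ}

/-- The Frobenius inner product of two real matrices. -/
def frobInner (B M : Matrix (Fin m) (Fin n) ℝ) : ℝ := ∑ j, ∑ k, B j k * M j k

lemma frobSq_eq_frobInner (M : Matrix (Fin m) (Fin n) ℝ) : frobSq M = frobInner M M := by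
  simp [frobSq, frobInner, sq]

lemma frobInner_eq_trace (B M : Matrix (Fin m) (Fin n) ℝ) :
    frobInner B M = (Bᵀ * M).trace := by
  simp only [frobInner, Matrix.trace, Matrix.diag, Matrix.mul_apply, Matrix.transpose_apply]
  exact Finset.sum_comm

lemma frobInner_add_right (B M N : Matrix (Fin m) (Fin n) ℝ) :
    frobInner B (M + N) = frobInner B M + frobInner B N := by
  simp [frobInner_eq_trace, Matrix.mul_add]

lemma frobInner_add_left (B M N : Matrix (Fin m) (Fin n) ℝ) :
    frobInner (B + M) N = frobInner B N + frobInner M N := by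
  simp [frobInner_eq_trace, Matrix.add_mul]

lemma frobInner_mul_mul {P : Matrix (Fin m) (Fin m) ℝ} {Q : Matrix (Fin n) (Fin n) ℝ}
    (hP : Pᵀ = P) (hQ : Qᵀ = Q) (B M : Matrix (Fin m) (Fin n) ℝ) :
    frobInner (P * B * Q) M = frobInner B (P * M * Q) := by
  simp only [frobInner_eq_trace, Matrix.transpose_mul, hP, hQ]
  rw [Matrix.mul_assoc, Matrix.trace_mul_comm]
  simp only [Matrix.mul_assoc]

lemma frobSq_nonneg (M : Matrix (Fin m) (Fin n) ℝ) : 0 ≤ frobSq M := by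
  unfold frobSq; positivity

lemma frobSq_smul (c : ℝ) (M : Matrix (Fin m) (Fin n) ℝ) : frobSq (c • M) = c ^ 2 * frobSq M := by
  simp [frobSq, mul_pow, Finset.mul_sum]

lemma frobSq_transpose (M : Matrix (Fin m) (Fin n) ℝ) : frobSq Mᵀ = frobSq M := by
  simp only [frobSq, Matrix.transpose_apply]
  exact Finset.sum_comm

/-- Parseval applied to each row. The freedom in the basis lets the inner product be computed along
the right singular vectors of `M`. -/
lemma frobInner_eq_sum_inner (v : OrthonormalBasis (Fin n) ℝ (EuclideanSpace ℝ (Fin n)))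
    (B M : Matrix (Fin m) (Fin n) ℝ) :
    frobInner B M = ∑ i, inner ℝ (toEuclideanLin B (v i)) (toEuclideanLin M (v i)) := by
  have key : ∀ (B : Matrix (Fin m) (Fin n) ℝ) (i : Fin n) (j : Fin m),
      (toEuclideanLin B (v i)) j = inner ℝ (WithLp.toLp 2 (B j)) (v i) := by
    intro B i j
    simp [Matrix.toLpLin_apply, Matrix.mulVec, PiLp.inner_apply, dotProduct, mul_comm]
  have e : ∀ i, inner ℝ (toEuclideanLin B (v i)) (toEuclideanLin M (v i)) =
      ∑ j, inner ℝ (WithLp.toLp 2 (B j)) (v i) * inner ℝ (v i) (WithLp.toLp 2 (M j)) := by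
    intro i
    rw [PiLp.inner_apply]
    refine Finset.sum_congr rfl fun j _ => ?_
    rw [key, key, real_inner_comm _ (v i), RCLike.inner_apply, conj_trivial, mul_comm]
  simp only [e]
  rw [Finset.sum_comm]
  unfold frobInner
  refine Finset.sum_congr rfl fun j _ => ?_
  have h := v.sum_inner_mul_inner (WithLp.toLp 2 (B j)) (WithLp.toLp 2 (M j))
  have h2 : inner ℝ (WithLp.toLp 2 (B j) : EuclideanSpace ℝ (Fin n)) (WithLp.toLp 2 (M j)) =
      ∑ k, B j k * M j k := by
    simp [PiLp.inner_apply, mul_comm]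
  rw [← h2, ← h]

/-- The right singular vectors of a linear map. -/
def rightSingularBasis {E F : Type*} [NormedAddCommGroup E] [InnerProductSpace ℝ E]
    [FiniteDimensional ℝ E] [NormedAddCommGroup F] [InnerProductSpace ℝ F]
    [FiniteDimensional ℝ F] (T : E →ₗ[ℝ] F) (hn : Module.finrank ℝ E = n) :
    OrthonormalBasis (Fin n) ℝ E :=
  T.isPositive_adjoint_comp_self.isSymmetric.eigenvectorBasis hn

/-- The basis diagonalizes `T* T` with eigenvalues the squared singular values; move one `T` across
the inner product. -/
lemma inner_apply_rightSingularBasis {E F : Type*} [NormedAddCommGroup E] [InnerProductSpace ℝ E]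
    [FiniteDimensional ℝ E] [NormedAddCommGroup F] [InnerProductSpace ℝ F]
    [FiniteDimensional ℝ F] (T : E →ₗ[ℝ] F) (hn : Module.finrank ℝ E = n) (i j : Fin n) :
    inner ℝ (T (rightSingularBasis T hn i)) (T (rightSingularBasis T hn j)) =
      if i = j then T.singularValues i ^ 2 else 0 := by
  rw [← LinearMap.adjoint_inner_left]
  have h := T.isPositive_adjoint_comp_self.isSymmetric.apply_eigenvectorBasis hn i
  have h' : LinearMap.adjoint T (T (rightSingularBasis T hn i)) =
      (T.singularValues i ^ 2) • rightSingularBasis T hn i := by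
    rw [LinearMap.sq_singularValues_fin _ hn]
    exact h
  rw [h', real_inner_smul_left, orthonormal_iff_ite.1 (rightSingularBasis T hn).orthonormal i j]
  simp

/-- The right singular vectors of a matrix. -/
def rightSingular (M : Matrix (Fin m) (Fin n) ℝ) :
    OrthonormalBasis (Fin n) ℝ (EuclideanSpace ℝ (Fin n)) :=
  rightSingularBasis (toEuclideanLin M) finrank_euclideanSpace_fin

lemma inner_apply_rightSingular (M : Matrix (Fin m) (Fin n) ℝ) (i j : Fin n) :
    inner ℝ (toEuclideanLin M (rightSingular M i)) (toEuclideanLin M (rightSingular M j)) =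
      if i = j then (toEuclideanLin M).singularValues i ^ 2 else 0 :=
  inner_apply_rightSingularBasis _ _ i j

lemma norm_apply_rightSingular (M : Matrix (Fin m) (Fin n) ℝ) (i : Fin n) :
    ‖toEuclideanLin M (rightSingular M i)‖ = (toEuclideanLin M).singularValues i := by
  have h := inner_apply_rightSingular M i i
  rw [real_inner_self_eq_norm_sq, if_pos rfl] at h
  exact (pow_left_inj₀ (norm_nonneg _) (LinearMap.singularValues_nonneg _ _) two_ne_zero).1 h

lemma frobSq_eq_sum_singularValues (M : Matrix (Fin m) (Fin n) ℝ) :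
    frobSq M = ∑ i : Fin n, (toEuclideanLin M).singularValues i ^ 2 := by
  rw [frobSq_eq_frobInner, frobInner_eq_sum_inner (rightSingular M)]
  simp only [inner_apply_rightSingular, if_true]

lemma nuclearNorm_nonneg (M : Matrix (Fin m) (Fin n) ℝ) : 0 ≤ nuclearNorm M :=
  Finset.sum_nonneg fun _ _ => LinearMap.singularValues_nonneg _ _

lemma spectralNorm_nonneg (M : Matrix (Fin m) (Fin n) ℝ) : 0 ≤ spectralNorm M := norm_nonneg _

lemma norm_toEuclideanLin_le (M : Matrix (Fin m) (Fin n) ℝ) (x : EuclideanSpace ℝ (Fin n)) :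
    ‖toEuclideanLin M x‖ ≤ spectralNorm M * ‖x‖ :=
  (LinearMap.toContinuousLinearMap (toEuclideanLin M)).le_opNorm x

lemma spectralNorm_le {M : Matrix (Fin m) (Fin n) ℝ} {c : ℝ} (hc : 0 ≤ c)
    (h : ∀ x, ‖toEuclideanLin M x‖ ≤ c * ‖x‖) : spectralNorm M ≤ c :=
  ContinuousLinearMap.opNorm_le_bound _ hc h

/-- Duality of the spectral and the nuclear norm. -/
lemma frobInner_le (B M : Matrix (Fin m) (Fin n) ℝ) :
    frobInner B M ≤ spectralNorm B * nuclearNorm M := by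
  rw [frobInner_eq_sum_inner (rightSingular M), nuclearNorm, Finset.mul_sum]
  refine Finset.sum_le_sum fun i _ => (real_inner_le_norm _ _).trans ?_
  rw [norm_apply_rightSingular]
  refine mul_le_mul_of_nonneg_right ?_ (LinearMap.singularValues_nonneg _ _)
  simpa using norm_toEuclideanLin_le B (rightSingular M i)

/-- The nuclear norm is attained in the duality. -/
lemma exists_frobInner_eq_nuclearNorm (M : Matrix (Fin m) (Fin n) ℝ) :
    ∃ B : Matrix (Fin m) (Fin n) ℝ, spectralNorm B ≤ 1 ∧ frobInner B M = nuclearNorm M := by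
  set v := rightSingular M
  set s : Fin n → ℝ := fun i => (toEuclideanLin M).singularValues i
  have hs : ∀ i, 0 ≤ s i := fun i => LinearMap.singularValues_nonneg _ _
  -- The partial isometry of the polar decomposition. Since `0⁻¹ = 0`, singular vectors in the
  -- kernel are sent to `0`.
  let L : EuclideanSpace ℝ (Fin n) →ₗ[ℝ] EuclideanSpace ℝ (Fin m) :=
    v.toBasis.constr ℝ fun i => (s i)⁻¹ • toEuclideanLin M (v i)
  have hL : ∀ i, L (v i) = (s i)⁻¹ • toEuclideanLin M (v i) := fun i => by
    simp [L]
  have hB : toEuclideanLin (toEuclideanLin.symm L) = L := LinearEquiv.apply_symm_apply _ _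
  refine ⟨toEuclideanLin.symm L, spectralNorm_le zero_le_one fun x => ?_, ?_⟩
  · rw [hB, one_mul]
    have hx : L x = ∑ i, inner ℝ (v i) x • ((s i)⁻¹ • toEuclideanLin M (v i)) := by
      conv_lhs => rw [← v.sum_repr' x]
      simp [map_sum, hL]
    have h1 : ‖L x‖ ^ 2 = ∑ i, inner ℝ (v i) x ^ 2 * ((s i)⁻¹ * s i) ^ 2 := by
      rw [← real_inner_self_eq_norm_sq, hx, sum_inner]
      refine Finset.sum_congr rfl fun i _ => ?_
      rw [inner_sum, Finset.sum_eq_single i]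
      · simp only [real_inner_smul_left, real_inner_smul_right, v, inner_apply_rightSingular,
          if_true]
        ring
      · intro j _ hj
        simp only [real_inner_smul_left, real_inner_smul_right, v, inner_apply_rightSingular,
          if_neg hj.symm, mul_zero]
      · simp
    have h2 : ‖L x‖ ^ 2 ≤ ‖x‖ ^ 2 := by
      rw [h1, ← v.sum_sq_norm_inner_right x]
      refine Finset.sum_le_sum fun i _ => ?_
      rw [Real.norm_eq_abs, sq_abs]
      by_cases h : s i = 0
      · simp [h, sq_nonneg]
      · simp [inv_mul_cancel₀ h]
    exact (pow_le_pow_iff_left₀ (norm_nonneg _) (norm_nonneg _) two_ne_zero).1 h2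
  · rw [frobInner_eq_sum_inner v, nuclearNorm, hB]
    refine Finset.sum_congr rfl fun i _ => ?_
    rw [hL, real_inner_smul_left]
    simp only [v, inner_apply_rightSingular, if_true]
    change (s i)⁻¹ * s i ^ 2 = s i
    by_cases h : s i = 0
    · simp [h]
    · field_simp

/-- By duality the nuclear norm is a maximum of linear functionals, hence subadditive. -/
lemma nuclearNorm_add_le (M N : Matrix (Fin m) (Fin n) ℝ) :
    nuclearNorm (M + N) ≤ nuclearNorm M + nuclearNorm N := by
  obtain ⟨B, hB, h⟩ := exists_frobInner_eq_nuclearNorm (M + N)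
  rw [← h, frobInner_add_right]
  have hM := (frobInner_le B M).trans (mul_le_of_le_one_left (nuclearNorm_nonneg M) hB)
  have hN := (frobInner_le B N).trans (mul_le_of_le_one_left (nuclearNorm_nonneg N) hB)
  linarith

lemma nuclearNorm_neg_le (M : Matrix (Fin m) (Fin n) ℝ) : nuclearNorm M ≤ nuclearNorm (-M) := by
  obtain ⟨B, hB, h⟩ := exists_frobInner_eq_nuclearNorm M
  have h1 : spectralNorm (-B) ≤ 1 := by
    simpa [spectralNorm] using hB
  have h2 : frobInner (-B) (-M) = frobInner B M := by
    simp [frobInner_eq_trace]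
  rw [← h, ← h2]
  exact (frobInner_le _ _).trans (mul_le_of_le_one_left (nuclearNorm_nonneg _) h1)

lemma nuclearNorm_neg (M : Matrix (Fin m) (Fin n) ℝ) : nuclearNorm (-M) = nuclearNorm M :=
  le_antisymm (by simpa using nuclearNorm_neg_le (-M)) (nuclearNorm_neg_le M)

lemma nuclearNorm_smul_le {c : ℝ} (hc : 0 ≤ c) (M : Matrix (Fin m) (Fin n) ℝ) :
    nuclearNorm (c • M) ≤ c * nuclearNorm M := by
  obtain ⟨B, hB, h⟩ := exists_frobInner_eq_nuclearNorm (c • M)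
  rw [← h]
  have h2 : frobInner B (c • M) = c * frobInner B M := by
    simp [frobInner_eq_trace]
  rw [h2]
  exact mul_le_mul_of_nonneg_left
    ((frobInner_le _ _).trans (mul_le_of_le_one_left (nuclearNorm_nonneg _) hB)) hc

lemma rank_eq_finrank_range_toEuclideanLin (M : Matrix (Fin m) (Fin n) ℝ) :
    M.rank = Module.finrank ℝ (LinearMap.range (toEuclideanLin M)) := by
  rw [show (toEuclideanLin M : EuclideanSpace ℝ (Fin n) →ₗ[ℝ] EuclideanSpace ℝ (Fin m)) =
    Matrix.toLin _ _ M from congrArg (fun f => f M) (Matrix.toLpLin_eq_toLin 2 2)]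
  exact Matrix.rank_eq_finrank_range_toLin M _ _

/-- The rank counts the nonzero singular values; apply Cauchy–Schwarz to their sum. -/
lemma nuclearNorm_le_sqrt_rank_mul {M : Matrix (Fin m) (Fin n) ℝ} {r : ℕ} (hr : M.rank ≤ r) :
    nuclearNorm M ≤ √r * √(frobSq M) := by
  set s : Fin n → ℝ := fun i => (toEuclideanLin M).singularValues i
  set S : Finset (Fin n) := Finset.univ.filter fun i => s i ≠ 0
  have hcard : S.card ≤ r := by
    refine le_trans ?_ (hr.trans' (rank_eq_finrank_range_toEuclideanLin M).ge)
    rw [← LinearMap.card_support_singularValues]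
    refine Finset.card_le_card_of_injOn (fun i => (i : ℕ)) (fun i hi => ?_)
      (fun i _ j _ h => Fin.ext h)
    exact Finsupp.mem_support_iff.2 (Finset.mem_filter.1 hi).2
  have h1 : nuclearNorm M = ∑ i ∈ S, s i := by
    rw [nuclearNorm]
    exact (Finset.sum_filter_ne_zero _).symm
  have h2 : frobSq M = ∑ i ∈ S, s i ^ 2 := by
    rw [frobSq_eq_sum_singularValues]
    refine (Finset.sum_subset (Finset.subset_univ S) fun i _ hi => ?_).symm
    have : s i = 0 := by simpa [S] using hi
    change s i ^ 2 = 0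
    simp [this]
  rw [← Real.sqrt_mul (Nat.cast_nonneg _)]
  refine Real.le_sqrt_of_sq_le ?_
  rw [h1, h2]
  refine (sq_sum_le_card_mul_sum_sq).trans ?_
  exact mul_le_mul_of_nonneg_right (by exact_mod_cast hcard) (by positivity)

lemma sqrt_frobSq_le_nuclearNorm (M : Matrix (Fin m) (Fin n) ℝ) :
    √(frobSq M) ≤ nuclearNorm M := by
  rw [Real.sqrt_le_left (nuclearNorm_nonneg M), frobSq_eq_sum_singularValues, nuclearNorm]
  exact Finset.sum_sq_le_sq_sum_of_nonneg fun _ _ => LinearMap.singularValues_nonneg _ _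

lemma toEuclideanLin_mul {k : ℕ} (A : Matrix (Fin k) (Fin m) ℝ) (B : Matrix (Fin m) (Fin n) ℝ)
    (x : EuclideanSpace ℝ (Fin n)) :
    toEuclideanLin (A * B) x = toEuclideanLin A (toEuclideanLin B x) := by
  simp [Matrix.toLpLin_apply, Matrix.mulVec_mulVec]

lemma inner_toEuclideanLin_left (A : Matrix (Fin m) (Fin n) ℝ) (x : EuclideanSpace ℝ (Fin n))
    (y : EuclideanSpace ℝ (Fin m)) :
    inner ℝ (toEuclideanLin A x) y = inner ℝ x (toEuclideanLin Aᵀ y) := by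
  simp only [Matrix.toLpLin_apply, EuclideanSpace.inner_eq_star_dotProduct, star_trivial]
  rw [Matrix.dotProduct_mulVec, Matrix.mulVec_transpose, dotProduct_comm]

/-- The matrix of the orthogonal projection onto the column space. -/
lemma exists_projection (A : Matrix (Fin m) (Fin n) ℝ) :
    ∃ P : Matrix (Fin m) (Fin m) ℝ, Pᵀ = P ∧ P * P = P ∧ P * A = A ∧ P.rank ≤ A.rank := by
  set K := LinearMap.range (toEuclideanLin A)
  set L : EuclideanSpace ℝ (Fin m) →ₗ[ℝ] EuclideanSpace ℝ (Fin m) := K.starProjection.toLinearMap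
  set P : Matrix (Fin m) (Fin m) ℝ := toEuclideanLin.symm L
  have hP : ∀ x, toEuclideanLin P x = K.starProjection x := fun x => by
    have : toEuclideanLin P = L := LinearEquiv.apply_symm_apply _ _
    rw [this]; rfl
  have ext : ∀ {k : ℕ} (B C : Matrix (Fin m) (Fin k) ℝ),
      (∀ x, toEuclideanLin B x = toEuclideanLin C x) → B = C := fun B C h =>
    toEuclideanLin.injective (LinearMap.ext h)
  refine ⟨P, ?_, ?_, ?_, ?_⟩
  · refine ext _ _ fun x => ext_inner_right ℝ fun y => ?_
    rw [inner_toEuclideanLin_left, Matrix.transpose_transpose, hP, hP]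
    exact (Submodule.inner_starProjection_left_eq_right K x y).symm
  · refine ext _ _ fun x => ?_
    rw [toEuclideanLin_mul, hP, hP]
    exact Submodule.starProjection_eq_self_iff.2 (Submodule.starProjection_apply_mem K x)
  · refine ext _ _ fun x => ?_
    rw [toEuclideanLin_mul, hP]
    exact Submodule.starProjection_eq_self_iff.2 (LinearMap.mem_range_self _ x)
  · rw [rank_eq_finrank_range_toEuclideanLin, rank_eq_finrank_range_toEuclideanLin A]
    refine Submodule.finrank_mono ?_
    rintro _ ⟨x, rfl⟩
    rw [hP]
    exact Submodule.starProjection_apply_mem K x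

lemma norm_sq_eq_add_of_projection {P : Matrix (Fin m) (Fin m) ℝ} (hP : Pᵀ = P) (hPP : P * P = P)
    (x : EuclideanSpace ℝ (Fin m)) :
    ‖x‖ ^ 2 = ‖toEuclideanLin P x‖ ^ 2 + ‖toEuclideanLin (1 - P) x‖ ^ 2 := by
  have h1 : toEuclideanLin (1 - P) x = x - toEuclideanLin P x := by
    simp [Matrix.toLpLin_apply]
  have h2 : inner ℝ x (toEuclideanLin P x) = ‖toEuclideanLin P x‖ ^ 2 := by
    rw [← real_inner_self_eq_norm_sq, inner_toEuclideanLin_left, hP, ← toEuclideanLin_mul, hPP]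
  rw [h1, norm_sub_sq_real, h2]
  ring

lemma frobSq_projection_mul {P : Matrix (Fin m) (Fin m) ℝ} (hP : Pᵀ = P) (hPP : P * P = P)
    (M : Matrix (Fin m) (Fin n) ℝ) : frobSq M = frobSq (P * M) + frobSq ((1 - P) * M) := by
  have h : ∀ M : Matrix (Fin m) (Fin n) ℝ, frobSq M =
      ∑ i, ‖toEuclideanLin M (EuclideanSpace.basisFun (Fin n) ℝ i)‖ ^ 2 := fun M => by
    rw [frobSq_eq_frobInner, frobInner_eq_sum_inner (EuclideanSpace.basisFun (Fin n) ℝ)]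
    simp only [real_inner_self_eq_norm_sq]
  rw [h M, h (P * M), h ((1 - P) * M), ← Finset.sum_add_distrib]
  refine Finset.sum_congr rfl fun i _ => ?_
  rw [toEuclideanLin_mul, toEuclideanLin_mul]
  exact norm_sq_eq_add_of_projection hP hPP _

lemma frobSq_projection_mul_le {P : Matrix (Fin m) (Fin m) ℝ} (hP : Pᵀ = P) (hPP : P * P = P)
    (M : Matrix (Fin m) (Fin n) ℝ) : frobSq (P * M) ≤ frobSq M := by
  have := frobSq_projection_mul hP hPP M
  have := frobSq_nonneg ((1 - P) * M)
  linarith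

lemma frobSq_mul_projection_le {Q : Matrix (Fin n) (Fin n) ℝ} (hQ : Qᵀ = Q) (hQQ : Q * Q = Q)
    (M : Matrix (Fin m) (Fin n) ℝ) : frobSq (M * Q) ≤ frobSq M := by
  rw [← frobSq_transpose, Matrix.transpose_mul, hQ, ← frobSq_transpose M]
  exact frobSq_projection_mul_le hQ hQQ _

lemma transpose_one_sub {P : Matrix (Fin m) (Fin m) ℝ} (hP : Pᵀ = P) : (1 - P)ᵀ = 1 - P := by
  rw [Matrix.transpose_sub, hP, Matrix.transpose_one]

lemma one_sub_mul_one_sub {P : Matrix (Fin m) (Fin m) ℝ} (hPP : P * P = P) :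
    (1 - P) * (1 - P) = 1 - P := by
  rw [Matrix.mul_sub, Matrix.sub_mul, Matrix.sub_mul, hPP]; simp

/-- Pinching: the nuclear norm dominates the nuclear norms of two complementary diagonal blocks. -/
lemma nuclearNorm_pinching {P : Matrix (Fin m) (Fin m) ℝ} (hP : Pᵀ = P) (hPP : P * P = P)
    {Q : Matrix (Fin n) (Fin n) ℝ} (hQ : Qᵀ = Q) (hQQ : Q * Q = Q)
    (M : Matrix (Fin m) (Fin n) ℝ) :
    nuclearNorm (P * M * Q) + nuclearNorm ((1 - P) * M * (1 - Q)) ≤ nuclearNorm M := by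
  obtain ⟨B, hB, h⟩ := exists_frobInner_eq_nuclearNorm (P * M * Q)
  obtain ⟨C, hC, h'⟩ := exists_frobInner_eq_nuclearNorm ((1 - P) * M * (1 - Q))
  rw [← h, ← h', ← frobInner_mul_mul hP hQ,
    ← frobInner_mul_mul (transpose_one_sub hP) (transpose_one_sub hQ), ← frobInner_add_left]
  refine (frobInner_le _ _).trans (mul_le_of_le_one_left (nuclearNorm_nonneg _) ?_)
  refine spectralNorm_le zero_le_one fun x => ?_
  rw [one_mul]
  refine (pow_le_pow_iff_left₀ (norm_nonneg _) (norm_nonneg _) two_ne_zero).1 ?_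
  -- The two dual certificates sit in complementary diagonal blocks, so their sum `D` is still a
  -- contraction: by Pythagoras for `P` on the target and for `Q` on the source, each block can be
  -- bounded separately.
  set D := P * B * Q + (1 - P) * C * (1 - Q)
  have hPD : P * D = P * (B * Q) := by
    simp only [D, Matrix.mul_add, ← Matrix.mul_assoc, hPP, Matrix.mul_sub, Matrix.mul_one, sub_self,
      Matrix.zero_mul, add_zero]
  have hPD' : (1 - P) * D = (1 - P) * (C * (1 - Q)) := by
    have h0 : (1 - P) * P = 0 := by rw [Matrix.sub_mul, hPP, Matrix.one_mul, sub_self]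
    simp only [D, Matrix.mul_add]
    rw [← Matrix.mul_assoc (1 - P), ← Matrix.mul_assoc (1 - P) P, h0, Matrix.zero_mul,
      Matrix.zero_mul, zero_add, ← Matrix.mul_assoc (1 - P), ← Matrix.mul_assoc (1 - P) (1 - P),
      one_sub_mul_one_sub hPP, Matrix.mul_assoc]
  rw [norm_sq_eq_add_of_projection hP hPP, norm_sq_eq_add_of_projection hQ hQQ x,
    ← toEuclideanLin_mul, ← toEuclideanLin_mul, hPD, hPD']
  have bound : ∀ {R : Matrix (Fin m) (Fin m) ℝ} (_ : Rᵀ = R) (_ : R * R = R)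
      {B : Matrix (Fin m) (Fin n) ℝ} (_ : spectralNorm B ≤ 1) (S : Matrix (Fin n) (Fin n) ℝ),
      ‖toEuclideanLin (R * (B * S)) x‖ ^ 2 ≤ ‖toEuclideanLin S x‖ ^ 2 := by
    intro R hR hRR B hB S
    rw [toEuclideanLin_mul, toEuclideanLin_mul]
    have h1 := norm_sq_eq_add_of_projection hR hRR (toEuclideanLin B (toEuclideanLin S x))
    have h2 : ‖toEuclideanLin B (toEuclideanLin S x)‖ ≤ ‖toEuclideanLin S x‖ :=
      (norm_toEuclideanLin_le B _).trans (mul_le_of_le_one_left (norm_nonneg _) hB)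
    have h3 := pow_le_pow_left₀ (norm_nonneg _) h2 2
    nlinarith [sq_nonneg ‖toEuclideanLin (1 - R) (toEuclideanLin B (toEuclideanLin S x))‖]
  exact add_le_add (bound hP hPP hB Q)
    (bound (transpose_one_sub hP) (one_sub_mul_one_sub hPP) hC (1 - Q))

/-- Perturbations of a matrix of rank at most `r` that do not increase the nuclear norm lie in the
cone where the nuclear norm is dominated by the Frobenius norm. -/
lemma nuclearNorm_le_of_nuclearNorm_add_le {A H : Matrix (Fin m) (Fin n) ℝ} {r : ℕ}
    (hr : A.rank ≤ r) (h : nuclearNorm (A + H) ≤ nuclearNorm A) :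
    nuclearNorm H ≤ 3 * √r * √(frobSq H) := by
  obtain ⟨P, hP, hPP, hPA, hPr⟩ := exists_projection A
  obtain ⟨Q, hQ, hQQ, hQA, hQr⟩ := exists_projection Aᵀ
  have hAQ : A * Q = A := by
    have := congrArg Matrix.transpose hQA
    rwa [Matrix.transpose_mul, Matrix.transpose_transpose, hQ] at this
  rw [Matrix.rank_transpose] at hQr
  have pinch := nuclearNorm_pinching hP hPP hQ hQQ (A + H)
  have e1 : P * (A + H) * Q = A + P * H * Q := by
    rw [Matrix.mul_add, Matrix.add_mul, hPA, hAQ]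
  have e2 : (1 - P) * (A + H) * (1 - Q) = (1 - P) * H * (1 - Q) := by
    rw [Matrix.mul_add, Matrix.add_mul, Matrix.sub_mul 1 P A, hPA]
    simp
  rw [e1, e2] at pinch
  have tri := nuclearNorm_add_le (A + P * H * Q) (-(P * H * Q))
  rw [add_neg_cancel_right, nuclearNorm_neg] at tri
  have rk : ∀ {M : Matrix (Fin m) (Fin n) ℝ}, M.rank ≤ r → frobSq M ≤ frobSq H →
      nuclearNorm M ≤ √r * √(frobSq H) := fun h1 h2 =>
    (nuclearNorm_le_sqrt_rank_mul h1).trans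
      (mul_le_mul_of_nonneg_left (Real.sqrt_le_sqrt h2) (Real.sqrt_nonneg _))
  have b1 : nuclearNorm (P * H * Q) ≤ √r * √(frobSq H) :=
    rk (((Matrix.rank_mul_le_right _ _).trans hQr).trans hr)
      ((frobSq_mul_projection_le hQ hQQ _).trans (frobSq_projection_mul_le hP hPP _))
  have b2 : nuclearNorm (P * H) ≤ √r * √(frobSq H) :=
    rk (((Matrix.rank_mul_le_left _ _).trans hPr).trans hr) (frobSq_projection_mul_le hP hPP _)
  have b3 : nuclearNorm ((1 - P) * H * Q) ≤ √r * √(frobSq H) :=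
    rk (((Matrix.rank_mul_le_right _ _).trans hQr).trans hr)
      ((frobSq_mul_projection_le hQ hQQ _).trans
        (frobSq_projection_mul_le (transpose_one_sub hP) (one_sub_mul_one_sub hPP) _))
  -- The first two pieces have rank at most `r`. For the last one, `pinch`, `h` and `tri` give `‖(1
  -- - P) H (1 - Q)‖_* ≤ ‖P H Q‖_*`, again of rank at most `r`. This is where the factor `3` comes
  -- from.
  have dec : H = P * H + ((1 - P) * H * Q + (1 - P) * H * (1 - Q)) := by
    rw [← Matrix.mul_add, add_sub_cancel, Matrix.mul_one, ← Matrix.add_mul, add_sub_cancel,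
      Matrix.one_mul]
  have t1 := nuclearNorm_add_le (P * H) ((1 - P) * H * Q + (1 - P) * H * (1 - Q))
  rw [← dec] at t1
  have t2 := nuclearNorm_add_le ((1 - P) * H * Q) ((1 - P) * H * (1 - Q))
  linarith

lemma continuous_frobSq : Continuous (frobSq : Matrix (Fin m) (Fin n) ℝ → ℝ) := by
  unfold frobSq; fun_prop

lemma continuous_spectralNorm : Continuous (spectralNorm : Matrix (Fin m) (Fin n) ℝ → ℝ) := by
  let L : Matrix (Fin m) (Fin n) ℝ →ₗ[ℝ] (EuclideanSpace ℝ (Fin n) →L[ℝ] EuclideanSpace ℝ (Fin m)) :=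
    LinearMap.toContinuousLinearMap.toLinearMap ∘ₗ toEuclideanLin.toLinearMap
  exact continuous_norm.comp L.continuous_of_finiteDimensional

/-- The nuclear norm is `√n`-Lipschitz for the Frobenius norm. -/
lemma continuous_nuclearNorm : Continuous (nuclearNorm : Matrix (Fin m) (Fin n) ℝ → ℝ) := by
  have key : ∀ M N : Matrix (Fin m) (Fin n) ℝ,
      nuclearNorm M - nuclearNorm N ≤ √n * √(frobSq (M - N)) := fun M N => by
    have h1 := nuclearNorm_add_le (M - N) N
    rw [sub_add_cancel] at h1
    have h2 := nuclearNorm_le_sqrt_rank_mul (Matrix.rank_le_width (M - N))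
    linarith
  refine continuous_iff_continuousAt.2 fun N => ?_
  have h0 : Filter.Tendsto (fun M : Matrix (Fin m) (Fin n) ℝ => √n * √(frobSq (M - N)))
      (nhds N) (nhds 0) := by
    have : Continuous fun M : Matrix (Fin m) (Fin n) ℝ => √n * √(frobSq (M - N)) :=
      continuous_const.mul (continuous_frobSq.comp (continuous_id.sub continuous_const)).sqrt
    simpa [frobSq] using this.tendsto N
  refine tendsto_iff_dist_tendsto_zero.2
    (squeeze_zero (fun _ => dist_nonneg) (fun M => ?_) h0)
  rw [Real.dist_eq, abs_le]
  have h1 := key N M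
  have h2 : frobSq (N - M) = frobSq (M - N) := by
    rw [← neg_sub M N]; simp only [frobSq, Matrix.neg_apply, neg_sq]
  rw [h2] at h1
  exact ⟨by linarith, key M N⟩

lemma isCompact_nuclearNorm_le (R : ℝ) :
    IsCompact {M : Matrix (Fin m) (Fin n) ℝ | nuclearNorm M ≤ R} := by
  have hK : IsCompact {M : Matrix (Fin m) (Fin n) ℝ | ∀ j, ∀ k, M j k ∈ Set.Icc (-R) R} := by
    have h1 : IsCompact {x : Fin n → ℝ | ∀ k, x k ∈ Set.Icc (-R) R} :=
      isCompact_pi_infinite fun _ => isCompact_Icc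
    exact isCompact_pi_infinite fun _ => h1
  refine hK.of_isClosed_subset (isClosed_le continuous_nuclearNorm continuous_const) ?_
  intro M hM j k
  have h1 : M j k ^ 2 ≤ frobSq M := by
    unfold frobSq
    refine le_trans ?_ (Finset.single_le_sum (f := fun j => ∑ k, M j k ^ 2)
      (fun _ _ => by positivity) (Finset.mem_univ j))
    exact Finset.single_le_sum (f := fun k => M j k ^ 2) (fun _ _ => by positivity)
      (Finset.mem_univ k)
  have h2 : |M j k| ≤ R := by
    rw [← Real.sqrt_sq_eq_abs]
    exact ((Real.sqrt_le_sqrt h1).trans (sqrt_frobSq_le_nuclearNorm M)).trans hM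
  exact abs_le.1 h2

end LinearAlgebra

/-! ### The deterministic error bound for the estimator. -/

section Estimator

variable {n p₁ p₂ : ℕ} {b : Fin n → Fin p₁ → ℝ} {g : Fin n → Fin p₂ → ℝ} {σ : ℝ}

lemma spectralNorm_sub_le (M N : Matrix (Fin p₁) (Fin p₂) ℝ) :
    spectralNorm (M - N) ≤ spectralNorm M + spectralNorm N := by
  simp only [spectralNorm, map_sub]
  exact norm_sub_le _ _

lemma ropDual_sub (w w' : Fin n → ℝ) : ropDual b g (w - w') = ropDual b g w - ropDual b g w' := by
  simp [ropDual, sub_smul, Finset.sum_sub_distrib]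

lemma ropDual_smul (c : ℝ) (w : Fin n → ℝ) : ropDual b g (c • w) = c • ropDual b g w := by
  simp [ropDual, Finset.smul_sum, smul_smul]

lemma frobInner_ropDual (w : Fin n → ℝ) (M : Matrix (Fin p₁) (Fin p₂) ℝ) :
    frobInner (ropDual b g w) M = ∑ i, w i * ropMap b g M i := by
  simp only [frobInner, ropDual, Matrix.sum_apply, Matrix.smul_apply, Matrix.vecMulVec_apply,
    smul_eq_mul, ropMap, LinearMap.coe_mk, AddHom.coe_mk, dotProduct, Matrix.mulVec,
    Finset.sum_mul, Finset.mul_sum]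
  rw [Finset.sum_comm' (t' := Finset.univ) (s' := fun _ => Finset.univ) (by simp)]
  simp only [Finset.sum_comm (s := Finset.univ (α := Fin p₁)) (t := Finset.univ (α := Fin n)),
    Finset.sum_comm (s := Finset.univ (α := Fin p₂)) (t := Finset.univ (α := Fin n))]
  refine Finset.sum_congr rfl fun i _ => ?_
  rw [Finset.sum_comm]
  refine Finset.sum_congr rfl fun j _ => Finset.sum_congr rfl fun k _ => ?_
  ring

lemma continuous_ropDual : Continuous (ropDual b g) := by
  unfold ropDual; fun_prop

lemma isClosed_feasible (y : Fin n → ℝ) : IsClosed (feasible b g σ y) := by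
  have hX : Continuous fun M => y - ropMap b g M :=
    continuous_const.sub (LinearMap.continuous_of_finiteDimensional _)
  refine IsClosed.inter ?_ ?_
  · refine isClosed_le ?_ continuous_const
    exact (continuous_finsetSum _ fun i _ => ((continuous_apply i).comp hX).abs).div_const _
  · exact isClosed_le (continuous_spectralNorm.comp (continuous_ropDual.comp hX)) continuous_const

/-- Only feasible points in a nuclear-norm sublevel set matter, and these form a compact set. -/
lemma exists_isEstimate {y : Fin n → ℝ} (h : (feasible b g σ y).Nonempty) :
    ∃ Ahat, IsEstimate b g σ y Ahat := by
  obtain ⟨A, hA⟩ := h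
  have hK := (isCompact_nuclearNorm_le (m := p₁) (n := p₂) (nuclearNorm A)).inter_left
    (isClosed_feasible (b := b) (g := g) (σ := σ) y)
  obtain ⟨M, ⟨hM, hMA⟩, hmin⟩ := hK.exists_isMinOn ⟨A, hA, le_refl (nuclearNorm A)⟩
    continuous_nuclearNorm.continuousOn
  refine ⟨M, hM, fun N hN => ?_⟩
  by_cases hNA : nuclearNorm N ≤ nuclearNorm A
  · exact hmin ⟨hN, hNA⟩
  · exact hMA.trans (not_le.1 hNA).le

lemma mem_feasible_of_noise_mem {A : Matrix (Fin p₁) (Fin p₂) ℝ} {z : Fin n → ℝ}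
    (hz : z ∈ constraintL1 n σ ∩ constraintDantzig b g σ) :
    A ∈ feasible b g σ (ropMap b g A + z) := by
  simpa [feasible] using hz

lemma eta_sq_le :
    eta n p₁ p₂ σ ^ 2 ≤ 288 * σ ^ 2 * (Real.log n * ((p₁ : ℝ) + p₂) ^ 2 + n * ((p₁ : ℝ) + p₂)) := by
  have hlog : 0 ≤ Real.log n := Real.log_natCast_nonneg n
  have h1 := Real.sq_sqrt hlog
  have hp : (0 : ℝ) ≤ 2 * n * ((p₁ : ℝ) + p₂) := by positivity
  have h2 := Real.sq_sqrt hp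
  have h3 : (12 * √(Real.log n) * ((p₁ : ℝ) + p₂) + 6 * √(2 * n * ((p₁ : ℝ) + p₂))) ^ 2 ≤
      2 * (12 * √(Real.log n) * ((p₁ : ℝ) + p₂)) ^ 2 +
        2 * (6 * √(2 * n * ((p₁ : ℝ) + p₂))) ^ 2 := by
    nlinarith [sq_nonneg (12 * √(Real.log n) * ((p₁ : ℝ) + p₂) - 6 * √(2 * n * ((p₁ : ℝ) + p₂)))]
  have h4 : 2 * (12 * √(Real.log n) * ((p₁ : ℝ) + p₂)) ^ 2 +
      2 * (6 * √(2 * n * ((p₁ : ℝ) + p₂))) ^ 2 =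
      288 * (Real.log n * ((p₁ : ℝ) + p₂) ^ 2) + 144 * (n * ((p₁ : ℝ) + p₂)) := by
    rw [mul_pow, mul_pow, mul_pow, h1, h2]; ring
  have h5 : (0 : ℝ) ≤ n * ((p₁ : ℝ) + p₂) := by positivity
  rw [eta, mul_pow]
  have h6 : (12 * √(Real.log n) * ((p₁ : ℝ) + p₂) + 6 * √(2 * n * ((p₁ : ℝ) + p₂))) ^ 2 ≤
      288 * (Real.log n * ((p₁ : ℝ) + p₂) ^ 2 + n * ((p₁ : ℝ) + p₂)) := by linarith
  nlinarith [mul_le_mul_of_nonneg_left h6 (sq_nonneg σ)]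

/-- The deterministic error bound: it suffices that the noise is feasible and that the `ℓ₁` norm of
the measurements dominates the Frobenius norm on the nuclear norm cone. -/
lemma frobSq_sub_le_of_isEstimate {r : ℕ} {z : Fin n → ℝ} (hn : 0 < n) (hσ : 0 ≤ σ)
    (hz : z ∈ constraintL1 n σ ∩ constraintDantzig b g σ)
    (hlow : ∀ H : Matrix (Fin p₁) (Fin p₂) ℝ, nuclearNorm H ≤ 3 * √r * √(frobSq H) →
      n / 6 * √(frobSq H) ≤ ∑ i, |ropMap b g H i|)
    {A Ahat : Matrix (Fin p₁) (Fin p₂) ℝ} (hA : A.rank ≤ r)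
    (hest : IsEstimate b g σ (ropMap b g A + z) Ahat) :
    frobSq (Ahat - A) ≤ (216 ^ 2 * 288) * σ ^ 2 * min
      (r * Real.log n * ((p₁ : ℝ) + p₂) ^ 2 / (n : ℝ) ^ 2 + r * ((p₁ : ℝ) + p₂) / n) 1 := by
  set H := Ahat - A with hH
  set F := √(frobSq H) with hF
  have hF0 : 0 ≤ F := Real.sqrt_nonneg _
  have hFsq : F ^ 2 = frobSq H := Real.sq_sqrt (frobSq_nonneg H)
  have hn' : (0 : ℝ) < n := by exact_mod_cast hn
  obtain ⟨hfeas, hmin⟩ := hest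
  have hnuc : nuclearNorm (A + H) ≤ nuclearNorm A := by
    rw [hH, add_sub_cancel]
    exact hmin (mem_feasible_of_noise_mem hz)
  have hcone := nuclearNorm_le_of_nuclearNorm_add_le hA hnuc
  have hl := hlow H hcone
  set z' := ropMap b g A + z - ropMap b g Ahat with hz'
  have hXH : ropMap b g H = z - z' := by
    rw [hH, hz', map_sub]; abel
  obtain ⟨hz1, hz2⟩ := hz
  obtain ⟨hf1, hf2⟩ := hfeas
  have hz1' : ∑ i, |z i| ≤ σ * n := (div_le_iff₀ hn').1 hz1
  have hf1' : ∑ i, |z' i| ≤ σ * n := (div_le_iff₀ hn').1 hf1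
  have hl1 : ∑ i, |ropMap b g H i| ≤ 2 * σ * n := by
    calc ∑ i, |ropMap b g H i| ≤ ∑ i, (|z i| + |z' i|) := by
          refine Finset.sum_le_sum fun i _ => ?_
          rw [hXH]
          exact abs_sub _ _
      _ ≤ 2 * σ * n := by rw [Finset.sum_add_distrib]; linarith
  have hη : 0 ≤ eta n p₁ p₂ σ := by unfold eta; positivity
  have hdual : spectralNorm (ropDual b g (ropMap b g H)) ≤ 2 * eta n p₁ p₂ σ := by
    rw [hXH, ropDual_sub]
    have h1 : spectralNorm (ropDual b g z) ≤ eta n p₁ p₂ σ := hz2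
    have h2 : spectralNorm (ropDual b g z') ≤ eta n p₁ p₂ σ := hf2
    linarith [spectralNorm_sub_le (ropDual b g z) (ropDual b g z')]
  have hl2 : ∑ i, ropMap b g H i ^ 2 ≤ 2 * eta n p₁ p₂ σ * (3 * √r * F) := by
    calc ∑ i, ropMap b g H i ^ 2 = frobInner (ropDual b g (ropMap b g H)) H := by
          rw [frobInner_ropDual]; simp [sq]
      _ ≤ _ := frobInner_le _ _
      _ ≤ _ := mul_le_mul hdual hcone (nuclearNorm_nonneg _) (by positivity)
  have hcs : (∑ i, |ropMap b g H i|) ^ 2 ≤ n * ∑ i, ropMap b g H i ^ 2 := by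
    have := sq_sum_le_card_mul_sum_sq (s := (Finset.univ : Finset (Fin n)))
      (f := fun i => |ropMap b g H i|)
    simpa using this
  have hF1 : F ≤ 12 * σ := by
    have h1 : n * F ≤ n * (12 * σ) := by linarith
    exact le_of_mul_le_mul_left h1 hn'
  -- Squaring the lower bound gives `n² F² / 36 ≤ n · 6 η √r F`; cancelling `n F` leaves the
  -- constant `36 · 6 = 216`. The case `F = 0` is separate because of this cancellation.
  have hF2 : F * n ≤ 216 * (√r * eta n p₁ p₂ σ) := by
    rcases hF0.eq_or_lt with h0 | h0
    · rw [← h0, zero_mul]; positivity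
    · have h1 : (n / 6 * F) ^ 2 ≤ n * (2 * eta n p₁ p₂ σ * (3 * √r * F)) :=
        (pow_le_pow_left₀ (by positivity) hl 2).trans
          (hcs.trans (mul_le_mul_of_nonneg_left hl2 hn'.le))
      have h2 : (n * F) * (F * n) ≤ (n * F) * (216 * (√r * eta n p₁ p₂ σ)) := by nlinarith
      exact le_of_mul_le_mul_left h2 (by positivity)
  rw [← hFsq, mul_min_of_nonneg _ _ (by positivity)]
  refine le_min ?_ ?_
  · have h1 := pow_le_pow_left₀ (by positivity) hF2 2
    rw [mul_pow, mul_pow, mul_pow, Real.sq_sqrt (Nat.cast_nonneg r)] at h1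
    have h2 := eta_sq_le (n := n) (p₁ := p₁) (p₂ := p₂) (σ := σ)
    have h3 : F ^ 2 * (n : ℝ) ^ 2 ≤ 216 ^ 2 * (r * (288 * σ ^ 2 *
        (Real.log n * ((p₁ : ℝ) + p₂) ^ 2 + n * ((p₁ : ℝ) + p₂)))) :=
      h1.trans (by gcongr)
    rw [← le_div_iff₀ (by positivity)] at h3
    refine h3.trans (le_of_eq ?_)
    field_simp
  · nlinarith [sq_nonneg σ]

end Estimator

/-! ### Gaussian moments and linear functionals of a Gaussian vector. -/

section Gaussian

open scoped ENNReal

lemma integral_abs_gaussianReal : ∫ x, |x| ∂(gaussianReal 0 1) = √(2 / Real.pi) := by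
  rw [integral_gaussianReal_eq_integral_smul one_ne_zero]
  have h : ∀ x : ℝ, gaussianPDFReal 0 1 x • |x| =
      (fun y : ℝ => (√(2 * Real.pi))⁻¹ * (y ^ (1 : ℝ) * Real.exp (-(1 / 2) * y ^ (2 : ℝ)))) |x| := by
    intro x
    simp only [gaussianPDFReal, smul_eq_mul, Real.rpow_one, Real.rpow_two, sq_abs, NNReal.coe_one,
      mul_one, sub_zero]
    rw [show -x ^ 2 / 2 = -(1 / 2) * x ^ 2 by ring]
    ring
  simp only [h]
  rw [integral_comp_abs (f := fun y : ℝ =>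
      (√(2 * Real.pi))⁻¹ * (y ^ (1 : ℝ) * Real.exp (-(1 / 2) * y ^ (2 : ℝ)))),
    integral_const_mul, integral_rpow_mul_exp_neg_mul_rpow (by norm_num) (by norm_num)
      (by norm_num)]
  have h1 : (-((1 : ℝ) + 1) / 2) = -1 := by norm_num
  have h2 : (((1 : ℝ) + 1) / 2) = 1 := by norm_num
  rw [h1, h2, Real.Gamma_one, Real.rpow_neg_one]
  have h3 : √(2 / Real.pi) = 2 * (√(2 * Real.pi))⁻¹ := by
    rw [eq_comm, ← sq_eq_sq₀ (by positivity) (by positivity), mul_pow, inv_pow,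
      Real.sq_sqrt (by positivity), Real.sq_sqrt (by positivity)]
    field_simp
  rw [h3]
  norm_num

lemma lintegral_exp_mul_sq_gaussianReal {s : ℝ} (hs : s < 1 / 2) :
    ∫⁻ x, ENNReal.ofReal (Real.exp (s * x ^ 2)) ∂(gaussianReal 0 1) =
      ENNReal.ofReal (√(1 - 2 * s))⁻¹ := by
  rw [gaussianReal_of_var_ne_zero _ one_ne_zero,
    lintegral_withDensity_eq_lintegral_mul _ (measurable_gaussianPDF 0 1) (by fun_prop)]
  have h : ∀ x : ℝ, (gaussianPDF 0 1 * fun x => ENNReal.ofReal (Real.exp (s * x ^ 2))) x =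
      ENNReal.ofReal ((√(2 * Real.pi))⁻¹ * Real.exp (-(1 / 2 - s) * x ^ 2)) := by
    intro x
    simp only [Pi.mul_apply, gaussianPDF, gaussianPDFReal]
    rw [← ENNReal.ofReal_mul (by positivity), mul_assoc, ← Real.exp_add]
    simp only [NNReal.coe_one, mul_one, sub_zero]
    congr 3
    ring
  simp only [h]
  have hint : Integrable (fun x : ℝ => (√(2 * Real.pi))⁻¹ * Real.exp (-(1 / 2 - s) * x ^ 2)) :=
    (integrable_exp_neg_mul_sq (by linarith)).const_mul _
  rw [← ofReal_integral_eq_lintegral_ofReal hint (Filter.Eventually.of_forall fun x => by positivity),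
    integral_const_mul, integral_gaussian, ← Real.sqrt_inv, ← Real.sqrt_mul (by positivity),
    ← Real.sqrt_inv]
  congr 2
  have : (1 : ℝ) - 2 * s ≠ 0 := by linarith
  have : (1 : ℝ) / 2 - s ≠ 0 := by linarith
  field_simp

lemma lintegral_exp_mul_gaussianReal (t : ℝ) :
    ∫⁻ x, ENNReal.ofReal (Real.exp (t * x)) ∂(gaussianReal 0 1) =
      ENNReal.ofReal (Real.exp (t ^ 2 / 2)) := by
  rw [← ofReal_integral_eq_lintegral_ofReal (integrable_exp_mul_gaussianReal t)
    (Filter.Eventually.of_forall fun x => by positivity)]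
  have := congrFun (mgf_id_gaussianReal (μ := 0) (v := 1)) t
  simp only [mgf, id, zero_mul, zero_add, NNReal.coe_one, one_mul] at this
  rw [this]

/-- The standard Gaussian measure on `ℝᵖ`. -/
abbrev stdPi (p : ℕ) : Measure (Fin p → ℝ) := Measure.pi fun _ => gaussianReal 0 1

/-- A linear functional of a Gaussian vector is Gaussian with variance `‖a‖²`. Writing the law as a
scaled standard Gaussian also covers `a = 0` without a case split. -/
lemma map_dotProduct_stdPi {p : ℕ} (a : Fin p → ℝ) :
    (stdPi p).map (fun x => a ⬝ᵥ x) = (gaussianReal 0 1).map fun y => √(a ⬝ᵥ a) * y := by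
  set L : StrongDual ℝ (EuclideanSpace ℝ (Fin p)) := innerSL ℝ (WithLp.toLp 2 a)
  have h1 : (fun x : Fin p → ℝ => a ⬝ᵥ x) = L ∘ WithLp.toLp 2 := by
    funext x
    simp [L, EuclideanSpace.inner_eq_star_dotProduct, dotProduct_comm]
  have h2 : ‖L‖ ^ 2 = a ⬝ᵥ a := by
    rw [innerSL_apply_norm, EuclideanSpace.norm_sq_eq]
    simp [dotProduct, sq]
  rw [h1, ← Measure.map_map (by fun_prop) (by fun_prop), map_pi_eq_stdGaussian,
    IsGaussian.map_eq_gaussianReal, integral_strongDual_stdGaussian, variance_dual_stdGaussian, h2,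
    gaussianReal_map_const_mul]
  congr 1
  · simp
  · ext
    have : 0 ≤ a ⬝ᵥ a := h2 ▸ sq_nonneg _
    simp [Real.sq_sqrt this, this]

lemma lintegral_dotProduct_stdPi {p : ℕ} (a : Fin p → ℝ) {f : ℝ → ℝ≥0∞} (hf : Measurable f) :
    ∫⁻ x, f (a ⬝ᵥ x) ∂(stdPi p) = ∫⁻ y, f (√(a ⬝ᵥ a) * y) ∂(gaussianReal 0 1) := by
  have hm : Measurable fun x : Fin p → ℝ => a ⬝ᵥ x := by unfold dotProduct; fun_prop
  rw [← lintegral_map hf hm, map_dotProduct_stdPi, lintegral_map hf (by fun_prop)]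

lemma integral_abs_dotProduct_stdPi {p : ℕ} (a : Fin p → ℝ) :
    ∫ x, |a ⬝ᵥ x| ∂(stdPi p) = √(2 / Real.pi) * √(a ⬝ᵥ a) := by
  have hm : Measurable fun x : Fin p → ℝ => a ⬝ᵥ x := by unfold dotProduct; fun_prop
  rw [← integral_map (f := fun y => |y|) hm.aemeasurable (by fun_prop), map_dotProduct_stdPi,
    integral_map (by fun_prop) (by fun_prop)]
  simp only [abs_mul, abs_of_nonneg (Real.sqrt_nonneg _)]
  rw [integral_const_mul, integral_abs_gaussianReal, mul_comm]

lemma integrable_dotProduct_stdPi {p : ℕ} (a : Fin p → ℝ) :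
    Integrable (fun x => a ⬝ᵥ x) (stdPi p) := by
  have hm : Measurable fun x : Fin p → ℝ => a ⬝ᵥ x := by unfold dotProduct; fun_prop
  have h : Integrable id ((stdPi p).map fun x => a ⬝ᵥ x) := by
    rw [map_dotProduct_stdPi, integrable_map_measure (by fun_prop) (by fun_prop)]
    exact ((memLp_id_gaussianReal 1).integrable (by norm_num)).const_mul _
  exact (integrable_map_measure (by fun_prop) hm.aemeasurable).1 h

end Gaussian

/-! ### Nets of the Euclidean ball and discretization of the spectral norm. -/

section Net

open scoped ENNReal

/-- A `1/4`-separated subset of the unit ball has at most `9 ^ dim` elements. -/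
lemma card_le_of_quarter_separated {E : Type*} [NormedAddCommGroup E] [NormedSpace ℝ E]
    [FiniteDimensional ℝ E] (s : Finset E) (hs : ∀ c ∈ s, ‖c‖ ≤ 1)
    (h : ∀ c ∈ s, ∀ d ∈ s, c ≠ d → 1 / 4 ≤ ‖c - d‖) : s.card ≤ 9 ^ Module.finrank ℝ E := by
  borelize E
  let μ : Measure E := Measure.addHaar
  -- Volume comparison: disjoint balls of radius `1/8` inside a ball of radius `9/8`, so the count
  -- is at most the ratio `9` to the power of the dimension.
  set A := ⋃ c ∈ s, Metric.ball (c : E) (1 / 8) with hA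
  have D : Set.Pairwise (s : Set E) (Function.onFun Disjoint fun c => Metric.ball (c : E) (1 / 8)) := by
    rintro c hc d hd hcd
    apply Metric.ball_disjoint_ball
    rw [dist_eq_norm]
    have := h c hc d hd hcd
    linarith
  have A_subset : A ⊆ Metric.ball (0 : E) (9 / 8) := by
    refine Set.iUnion₂_subset fun x hx => ?_
    apply Metric.ball_subset_ball'
    rw [dist_zero_right]
    have := hs x hx
    linarith
  have I : (s.card : ℝ≥0∞) * ENNReal.ofReal ((1 / 8) ^ Module.finrank ℝ E) * μ (Metric.ball 0 1) ≤
      ENNReal.ofReal ((9 / 8) ^ Module.finrank ℝ E) * μ (Metric.ball 0 1) :=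
    calc
      (s.card : ℝ≥0∞) * ENNReal.ofReal ((1 / 8) ^ Module.finrank ℝ E) * μ (Metric.ball 0 1) = μ A := by
        rw [hA, measure_biUnion_finset D fun c _ => measurableSet_ball]
        simp only [μ.addHaar_ball_of_pos _ (show (0 : ℝ) < 1 / 8 by norm_num)]
        simp only [Finset.sum_const, nsmul_eq_mul, mul_assoc]
      _ ≤ μ (Metric.ball (0 : E) (9 / 8)) := measure_mono A_subset
      _ = ENNReal.ofReal ((9 / 8) ^ Module.finrank ℝ E) * μ (Metric.ball 0 1) := by
        simp only [μ.addHaar_ball_of_pos _ (show (0 : ℝ) < 9 / 8 by norm_num)]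
  have J := (ENNReal.mul_le_mul_iff_left (Metric.measure_ball_pos _ _ zero_lt_one).ne'
    measure_ball_lt_top.ne).1 I
  have K : (s.card : ℝ) ≤ (9 : ℝ) ^ Module.finrank ℝ E := by
    have := ENNReal.toReal_le_of_le_ofReal (by positivity) J
    rw [ENNReal.toReal_mul, ENNReal.toReal_natCast, ENNReal.toReal_ofReal (by positivity),
      show (9 / 8 : ℝ) = 9 * (1 / 8) by norm_num, mul_pow] at this
    exact le_of_mul_le_mul_right this (by positivity)
  exact_mod_cast K

/-- A finite `1/4`-net of the Euclidean unit ball. -/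
lemma exists_quarter_net (p : ℕ) : ∃ N : Finset (EuclideanSpace ℝ (Fin p)),
    (∀ c ∈ N, ‖c‖ ≤ 1) ∧ N.card ≤ 9 ^ p ∧ ∀ x, ‖x‖ ≤ 1 → ∃ c ∈ N, ‖x - c‖ ≤ 1 / 4 := by
  classical
  -- A separated set of maximal cardinality is a net, since an uncovered point could be added to it.
  let P : ℕ → Prop := fun k => ∃ s : Finset (EuclideanSpace ℝ (Fin p)), s.card = k ∧
    (∀ c ∈ s, ‖c‖ ≤ 1) ∧ ∀ c ∈ s, ∀ d ∈ s, c ≠ d → 1 / 4 ≤ ‖c - d‖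
  have hP0 : P 0 := ⟨∅, by simp⟩
  have hbound : ∀ k, P k → k ≤ 9 ^ p := by
    rintro k ⟨s, rfl, h1, h2⟩
    simpa using card_le_of_quarter_separated s h1 h2
  obtain ⟨s, hcard, h1, h2⟩ : P (Nat.findGreatest P (9 ^ p)) :=
    Nat.findGreatest_spec (Nat.zero_le _) hP0
  refine ⟨s, h1, hcard ▸ Nat.findGreatest_le _, fun x hx => ?_⟩
  by_contra! hcon
  have hxs : x ∉ s := fun hxs => by
    have := hcon x hxs
    rw [sub_self, norm_zero] at this
    norm_num at this
  have hP : P (s.card + 1) := by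
    refine ⟨insert x s, Finset.card_insert_of_notMem hxs, ?_, ?_⟩
    · intro c hc
      rcases Finset.mem_insert.1 hc with rfl | hc
      exacts [hx, h1 c hc]
    · intro c hc d hd hcd
      rcases Finset.mem_insert.1 hc with hc' | hc' <;> rcases Finset.mem_insert.1 hd with hd' | hd'
      · exact absurd (hc'.trans hd'.symm) hcd
      · rw [hc']; exact (hcon d hd').le
      · rw [hd', norm_sub_rev]; exact (hcon c hc').le
      · exact h2 c hc' d hd' hcd
  have := Nat.le_findGreatest (hbound _ hP) hP
  omega

/-- Rounding each of the two unit vectors to its net costs at most a quarter of the spectral norm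
`K`, so `K ≤ c + K / 2` with `c` the maximum over the nets. -/
lemma exists_spectralNorm_le_two_mul_abs_inner {p₁ p₂ : ℕ}
    {N₁ : Finset (EuclideanSpace ℝ (Fin p₁))} {N₂ : Finset (EuclideanSpace ℝ (Fin p₂))}
    (hN₁ : ∀ x, ‖x‖ ≤ 1 → ∃ c ∈ N₁, ‖x - c‖ ≤ 1 / 4)
    (hN₂ : ∀ x, ‖x‖ ≤ 1 → ∃ c ∈ N₂, ‖x - c‖ ≤ 1 / 4) (h1 : ∀ c ∈ N₂, ‖c‖ ≤ 1)
    (M : Matrix (Fin p₁) (Fin p₂) ℝ) :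
    ∃ u ∈ N₁, ∃ v ∈ N₂, spectralNorm M ≤ 2 * |inner ℝ u (toEuclideanLin M v)| := by
  obtain ⟨u₀, hu₀, -⟩ := hN₁ 0 (by simp)
  obtain ⟨v₀, hv₀, -⟩ := hN₂ 0 (by simp)
  obtain ⟨⟨u, v⟩, huv, hmax⟩ := (N₁ ×ˢ N₂).exists_max_image
    (fun q => |inner ℝ q.1 (toEuclideanLin M q.2)|) ⟨(u₀, v₀), Finset.mk_mem_product hu₀ hv₀⟩
  obtain ⟨hu, hv⟩ := Finset.mem_product.1 huv
  refine ⟨u, hu, v, hv, ?_⟩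
  set c := |inner ℝ u (toEuclideanLin M v)|
  have hc : 0 ≤ c := abs_nonneg _
  set K := spectralNorm M
  have hK : 0 ≤ K := spectralNorm_nonneg M
  have step1 : ∀ v' ∈ N₂, ‖toEuclideanLin M v'‖ ≤ c + K / 4 := by
    intro v' hv'
    set y := toEuclideanLin M v' with hy
    have hyK : ‖y‖ ≤ K := (norm_toEuclideanLin_le M v').trans (mul_le_of_le_one_right hK (h1 v' hv'))
    obtain ⟨u', hu', hd⟩ := hN₁ (‖y‖⁻¹ • y) (by
      rw [norm_smul, norm_inv, norm_norm]
      exact inv_mul_le_one)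
    have e1 : inner ℝ (‖y‖⁻¹ • y) y = ‖y‖ := by
      rw [real_inner_smul_left, real_inner_self_eq_norm_sq]
      by_cases h0 : ‖y‖ = 0
      · simp [h0]
      · field_simp
    have e2 : inner ℝ (‖y‖⁻¹ • y) y = inner ℝ u' y + inner ℝ (‖y‖⁻¹ • y - u') y := by
      rw [← inner_add_left, add_sub_cancel]
    have e3 : inner ℝ (‖y‖⁻¹ • y - u') y ≤ 1 / 4 * K :=
      (real_inner_le_norm _ _).trans (mul_le_mul hd hyK (norm_nonneg _) (by norm_num))
    have e4 : inner ℝ u' y ≤ c :=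
      (le_abs_self _).trans (hmax (u', v') (Finset.mk_mem_product hu' hv'))
    linarith
  have step2 : K ≤ c + K / 2 := by
    refine ContinuousLinearMap.opNorm_le_of_unit_norm (by positivity) fun x hx => ?_
    obtain ⟨v', hv', hd⟩ := hN₂ x hx.le
    have e1 : toEuclideanLin M x = toEuclideanLin M v' + toEuclideanLin M (x - v') := by
      rw [← map_add, add_sub_cancel]
    have e2 : ‖toEuclideanLin M (x - v')‖ ≤ K * (1 / 4) :=
      (norm_toEuclideanLin_le M _).trans (mul_le_mul_of_nonneg_left hd hK)
    change ‖toEuclideanLin M x‖ ≤ _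
    rw [e1]
    linarith [norm_add_le (toEuclideanLin M v') (toEuclideanLin M (x - v')), step1 v' hv']
  linarith

end Net

/-! ### Exponential moments of the spectral norm of the dual operator. -/

section ExponentialMoment

open scoped ENNReal

variable {n p₁ p₂ : ℕ}

/-- The law of a single pair `(β, γ)` of the Gaussian design. -/
abbrev samplePair (p₁ p₂ : ℕ) : Measure ((Fin p₁ → ℝ) × (Fin p₂ → ℝ)) :=
  (stdPi p₁).prod (stdPi p₂)

/-- The law of `n` independent pairs of the Gaussian design. -/
abbrev sampleLaw (n p₁ p₂ : ℕ) : Measure (Fin n → (Fin p₁ → ℝ) × (Fin p₂ → ℝ)) :=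
  Measure.pi fun _ => samplePair p₁ p₂

lemma measurable_dotProduct_left {p : ℕ} (a : Fin p → ℝ) : Measurable fun x => a ⬝ᵥ x := by
  unfold dotProduct; fun_prop

/-- Integrating over `γ` first gives the exponential of a multiple of `(uᵀ β)²`; the integral over
`β` is then the exponential moment of a squared Gaussian, finite because `t² < 1`. -/
lemma lintegral_exp_mul_dotProduct (t : ℝ) (ht : t ^ 2 < 1) {u : Fin p₁ → ℝ} {v : Fin p₂ → ℝ}
    (hu : u ⬝ᵥ u ≤ 1) (hv : v ⬝ᵥ v ≤ 1) :
    ∫⁻ X, ENNReal.ofReal (Real.exp (t * ((u ⬝ᵥ X.1) * (v ⬝ᵥ X.2)))) ∂(samplePair p₁ p₂) ≤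
      ENNReal.ofReal (√(1 - t ^ 2))⁻¹ := by
  have hm1 := measurable_dotProduct_left u
  have hm2 := measurable_dotProduct_left v
  have hu0 : 0 ≤ u ⬝ᵥ u := Finset.sum_nonneg fun _ _ => mul_self_nonneg _
  have hv0 : 0 ≤ v ⬝ᵥ v := Finset.sum_nonneg fun _ _ => mul_self_nonneg _
  rw [lintegral_prod _ (by fun_prop)]
  have inner_eq : ∀ x : Fin p₁ → ℝ,
      ∫⁻ y, ENNReal.ofReal (Real.exp (t * ((u ⬝ᵥ x) * (v ⬝ᵥ y)))) ∂(stdPi p₂) =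
        ENNReal.ofReal (Real.exp ((t * (u ⬝ᵥ x)) ^ 2 * (v ⬝ᵥ v) / 2)) := by
    intro x
    have := lintegral_dotProduct_stdPi v
      (f := fun y => ENNReal.ofReal (Real.exp (t * ((u ⬝ᵥ x) * y)))) (by fun_prop)
    rw [this]
    have h2 : ∀ y : ℝ, t * ((u ⬝ᵥ x) * (√(v ⬝ᵥ v) * y)) = (t * (u ⬝ᵥ x) * √(v ⬝ᵥ v)) * y :=
      fun y => by ring
    simp only [h2]
    rw [lintegral_exp_mul_gaussianReal, mul_pow, Real.sq_sqrt hv0]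
  simp only [inner_eq]
  have := lintegral_dotProduct_stdPi u
    (f := fun y => ENNReal.ofReal (Real.exp ((t * y) ^ 2 * (v ⬝ᵥ v) / 2))) (by fun_prop)
  rw [this]
  have hle : t ^ 2 * (u ⬝ᵥ u) * (v ⬝ᵥ v) ≤ t ^ 2 := by
    have h1 : (u ⬝ᵥ u) * (v ⬝ᵥ v) ≤ 1 := mul_le_one₀ hu hv0 hv
    calc t ^ 2 * (u ⬝ᵥ u) * (v ⬝ᵥ v) = t ^ 2 * ((u ⬝ᵥ u) * (v ⬝ᵥ v)) := by ring
      _ ≤ t ^ 2 := mul_le_of_le_one_right (sq_nonneg t) h1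
  have h3 : ∀ y : ℝ, (t * (√(u ⬝ᵥ u) * y)) ^ 2 * (v ⬝ᵥ v) / 2 ≤ t ^ 2 / 2 * y ^ 2 := fun y => by
    rw [mul_pow, mul_pow, Real.sq_sqrt hu0]
    nlinarith [sq_nonneg y]
  calc _ ≤ ∫⁻ y, ENNReal.ofReal (Real.exp (t ^ 2 / 2 * y ^ 2)) ∂(gaussianReal 0 1) :=
        lintegral_mono fun y => ENNReal.ofReal_le_ofReal (Real.exp_le_exp.2 (h3 y))
    _ = _ := by
        rw [lintegral_exp_mul_sq_gaussianReal (by linarith)]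
        congr 4
        ring

lemma lintegral_pi_prod {𝓧 : Type*} [MeasurableSpace 𝓧] (ρ : Measure 𝓧) [IsProbabilityMeasure ρ]
    {f : Fin n → 𝓧 → ℝ≥0∞} (hf : ∀ i, Measurable (f i)) :
    ∫⁻ X, ∏ i, f i (X i) ∂(Measure.pi fun _ : Fin n => ρ) = ∏ i, ∫⁻ x, f i x ∂ρ := by
  have hind : iIndepFun (fun i (X : Fin n → 𝓧) => f i (X i)) (Measure.pi fun _ : Fin n => ρ) :=
    iIndepFun_pi fun i => (hf i).aemeasurable
  rw [lintegral_prod_eq_prod_lintegral_of_indepFun Finset.univ _ hind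
    fun i => (hf i).comp (measurable_pi_apply i)]
  refine Finset.prod_congr rfl fun i _ => ?_
  exact (measurePreserving_eval (fun _ : Fin n => ρ) i).lintegral_comp (hf i)

lemma inner_toEuclideanLin_ropDual (b : Fin n → Fin p₁ → ℝ) (g : Fin n → Fin p₂ → ℝ)
    (w : Fin n → ℝ) (u : EuclideanSpace ℝ (Fin p₁)) (v : EuclideanSpace ℝ (Fin p₂)) :
    inner ℝ u (toEuclideanLin (ropDual b g w) v) =
      ∑ i, w i * ((u.ofLp ⬝ᵥ b i) * (v.ofLp ⬝ᵥ g i)) := by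
  rw [EuclideanSpace.inner_eq_star_dotProduct, star_trivial, Matrix.toLpLin_apply, ropDual,
    Matrix.sum_mulVec, sum_dotProduct]
  refine Finset.sum_congr rfl fun i _ => ?_
  rw [Matrix.smul_mulVec, Matrix.vecMulVec_mulVec, smul_dotProduct]
  rw [dotProduct_comm, dotProduct_smul, dotProduct_comm (v.ofLp)]
  simp only [MulOpposite.smul_eq_mul_unop, MulOpposite.unop_op, smul_eq_mul]

/-- Exponential moments of the spectral norm of `𝒳*(w)` for a Gaussian design. -/
lemma lintegral_exp_spectralNorm_ropDual_le {t : ℝ} (ht : 0 ≤ t) {w : Fin n → ℝ}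
    (hw : ∀ i, (2 * t * w i) ^ 2 < 1) :
    ∫⁻ X, ENNReal.ofReal (Real.exp (t * spectralNorm
      (ropDual (fun i => (X i).1) (fun i => (X i).2) w))) ∂(sampleLaw n p₁ p₂) ≤
      2 * 9 ^ (p₁ + p₂) * ∏ i, ENNReal.ofReal (√(1 - (2 * t * w i) ^ 2))⁻¹ := by
  obtain ⟨N₁, h1, c1, n1⟩ := exists_quarter_net p₁
  obtain ⟨N₂, h2, c2, n2⟩ := exists_quarter_net p₂
  set B := ∏ i, ENNReal.ofReal (√(1 - (2 * t * w i) ^ 2))⁻¹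
  have hdot : ∀ {p : ℕ} (x : EuclideanSpace ℝ (Fin p)), ‖x‖ ≤ 1 → x.ofLp ⬝ᵥ x.ofLp ≤ 1 := by
    intro p x hx
    have : x.ofLp ⬝ᵥ x.ofLp = ‖x‖ ^ 2 := by
      rw [EuclideanSpace.norm_sq_eq]; simp [dotProduct, sq]
    rw [this]
    exact pow_le_one₀ (norm_nonneg _) hx
  let f : ℝ → EuclideanSpace ℝ (Fin p₁) → EuclideanSpace ℝ (Fin p₂) →
      (Fin n → (Fin p₁ → ℝ) × (Fin p₂ → ℝ)) → ℝ≥0∞ := fun s u v X =>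
    ∏ i, ENNReal.ofReal (Real.exp ((s * w i) * ((u.ofLp ⬝ᵥ (X i).1) * (v.ofLp ⬝ᵥ (X i).2))))
  have hmeas1 : ∀ (s : ℝ) (u : EuclideanSpace ℝ (Fin p₁)) (v : EuclideanSpace ℝ (Fin p₂)),
      Measurable fun x : (Fin p₁ → ℝ) × (Fin p₂ → ℝ) =>
        ENNReal.ofReal (Real.exp (s * ((u.ofLp ⬝ᵥ x.1) * (v.ofLp ⬝ᵥ x.2)))) := by
    intro s u v
    have hm1 := measurable_dotProduct_left u.ofLp
    have hm2 := measurable_dotProduct_left v.ofLp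
    fun_prop
  have hmeas : ∀ s u v, Measurable (f s u v) := fun s u v =>
    Finset.measurable_prod _ fun i _ => (hmeas1 (s * w i) u v).comp (measurable_pi_apply i)
  have hf : ∀ s, s ^ 2 = (2 * t) ^ 2 → ∀ u ∈ N₁, ∀ v ∈ N₂,
      ∫⁻ X, f s u v X ∂(sampleLaw n p₁ p₂) ≤ B := by
    intro s hs u hu v hv
    rw [lintegral_pi_prod _ fun i => hmeas1 (s * w i) u v]
    refine Finset.prod_le_prod' fun i _ => ?_
    have e : (2 * t * w i) ^ 2 = (s * w i) ^ 2 := by rw [mul_pow, mul_pow s, hs]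
    rw [e]
    exact lintegral_exp_mul_dotProduct _ (e ▸ hw i) (hdot u (h1 u hu)) (hdot v (h2 v hv))
  -- The maximum over the net is bounded by the sum, and both signs are included to absorb the
  -- absolute value. The parameter doubles because discretization loses a factor `2`.
  calc _ ≤ ∫⁻ X, ∑ u ∈ N₁, ∑ v ∈ N₂, (f (2 * t) u v X + f (-(2 * t)) u v X)
        ∂(sampleLaw n p₁ p₂) := by
        refine lintegral_mono fun X => ?_
        obtain ⟨u, hu, v, hv, huv⟩ := exists_spectralNorm_le_two_mul_abs_inner n1 n2 h2
          (ropDual (fun i => (X i).1) (fun i => (X i).2) w)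
        have hfs : ∀ s, f s u v X = ENNReal.ofReal (Real.exp (s * inner ℝ u
            (toEuclideanLin (ropDual (fun i => (X i).1) (fun i => (X i).2) w) v))) := by
          intro s
          rw [inner_toEuclideanLin_ropDual, Finset.mul_sum, Real.exp_sum,
            ENNReal.ofReal_prod_of_nonneg fun i _ => (Real.exp_pos _).le]
          refine Finset.prod_congr rfl fun i _ => ?_
          rw [mul_assoc]
        set q := inner ℝ u (toEuclideanLin (ropDual (fun i => (X i).1) (fun i => (X i).2) w) v)
        refine le_trans ?_ (Finset.single_le_sum (f := fun u => ∑ v ∈ N₂,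
          (f (2 * t) u v X + f (-(2 * t)) u v X)) (fun _ _ => zero_le) hu)
        refine le_trans ?_ (Finset.single_le_sum (f := fun v =>
          (f (2 * t) u v X + f (-(2 * t)) u v X)) (fun _ _ => zero_le) hv)
        rw [hfs, hfs]
        rcases abs_cases q with ⟨hq, -⟩ | ⟨hq, -⟩
        · refine le_trans (ENNReal.ofReal_le_ofReal (Real.exp_le_exp.2 ?_)) le_self_add
          rw [hq] at huv
          nlinarith
        · refine le_trans (ENNReal.ofReal_le_ofReal (Real.exp_le_exp.2 ?_)) le_add_self
          rw [hq] at huv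
          nlinarith
    _ = ∑ u ∈ N₁, ∑ v ∈ N₂, ∫⁻ X, (f (2 * t) u v X + f (-(2 * t)) u v X)
        ∂(sampleLaw n p₁ p₂) := by
        have hm2 : ∀ u v, Measurable fun X => f (2 * t) u v X + f (-(2 * t)) u v X :=
          fun u v => (hmeas _ u v).add (hmeas _ u v)
        rw [lintegral_finsetSum _ fun u _ => Finset.measurable_fun_sum _ fun v _ => hm2 u v]
        exact Finset.sum_congr rfl fun u _ => lintegral_finsetSum _ fun v _ => hm2 u v
    _ ≤ ∑ u ∈ N₁, ∑ v ∈ N₂, 2 * B := by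
        refine Finset.sum_le_sum fun u hu => Finset.sum_le_sum fun v hv => ?_
        rw [lintegral_add_left (hmeas _ u v), two_mul B]
        exact add_le_add (hf (2 * t) rfl u hu v hv) (hf (-(2 * t)) (by ring) u hu v hv)
    _ = (N₁.card * N₂.card : ℕ) * (2 * B) := by
        simp only [Finset.sum_const, nsmul_eq_mul, Nat.cast_mul]
        ring
    _ ≤ ((9 ^ (p₁ + p₂) : ℕ) : ℝ≥0∞) * (2 * B) := by
        gcongr
        rw [pow_add]
        exact Nat.mul_le_mul c1 c2
    _ = _ := by
        push_cast
        ring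

end ExponentialMoment

/-! ### Symmetrization and contraction for exponential suprema. -/

section Symmetrization

open scoped ENNReal

variable {𝓧 ι : Type*} [MeasurableSpace 𝓧] {ρ : Measure 𝓧}

lemma ofReal_integral_le_lintegral_ofReal {g : 𝓧 → ℝ} (hg : Integrable g ρ) :
    ENNReal.ofReal (∫ X, g X ∂ρ) ≤ ∫⁻ X, ENNReal.ofReal (g X) ∂ρ := by
  have h1 : ∫ X, g X ∂ρ ≤ ∫ X, max (g X) 0 ∂ρ :=
    integral_mono hg hg.pos_part fun X => le_max_left _ _
  refine (ENNReal.ofReal_le_ofReal h1).trans (le_of_eq ?_)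
  rw [ofReal_integral_eq_lintegral_ofReal hg.pos_part
    (Filter.Eventually.of_forall fun X => le_max_right _ _)]
  refine lintegral_congr fun X => ?_
  rcases le_total (g X) 0 with h | h
  · rw [max_eq_right h, ENNReal.ofReal_of_nonpos h, ENNReal.ofReal_zero]
  · rw [max_eq_left h]

/-- Jensen's inequality for the exponential. -/
lemma ofReal_exp_integral_le [IsProbabilityMeasure ρ] {f : 𝓧 → ℝ} (hf : Integrable f ρ) (c : ℝ) :
    ENNReal.ofReal (Real.exp (c + ∫ X, f X ∂ρ)) ≤
      ∫⁻ X, ENNReal.ofReal (Real.exp (c + f X)) ∂ρ := by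
  set m := ∫ X, f X ∂ρ with hm
  have hint : Integrable (fun X => Real.exp (c + m) * (1 - m + f X)) ρ :=
    ((integrable_const _).add hf).const_mul _
  have hval : ∫ X, Real.exp (c + m) * (1 - m + f X) ∂ρ = Real.exp (c + m) := by
    rw [integral_const_mul, integral_add (integrable_const _) hf, ← hm]
    simp
  rw [← hval]
  refine (ofReal_integral_le_lintegral_ofReal hint).trans
    (lintegral_mono fun X => ENNReal.ofReal_le_ofReal ?_)
  have h1 : c + f X = (c + m) + (f X - m) := by ring
  rw [h1, Real.exp_add (c + m)]
  refine mul_le_mul_of_nonneg_left ?_ (Real.exp_pos _).le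
  linarith [Real.add_one_le_exp (f X - m)]

/-- With `P` and `Q` the two suprema on the right, the one with `+|y|` is at most `max P Q` and the
one with `-|y|` at most `min P Q`; now use `max P Q + min P Q = P + Q`. This is the contraction step
that removes absolute values. -/
lemma iSup_exp_abs_add_le (a y : ι → ℝ) :
    (⨆ h, ENNReal.ofReal (Real.exp (a h + |y h|))) + (⨆ h, ENNReal.ofReal (Real.exp (a h - |y h|))) ≤
      (⨆ h, ENNReal.ofReal (Real.exp (a h + y h))) +
        ⨆ h, ENNReal.ofReal (Real.exp (a h + -y h)) := by
  set P := ⨆ h, ENNReal.ofReal (Real.exp (a h + y h))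
  set Q := ⨆ h, ENNReal.ofReal (Real.exp (a h + -y h))
  have hP : ∀ h, ENNReal.ofReal (Real.exp (a h + y h)) ≤ P :=
    le_iSup fun h => ENNReal.ofReal (Real.exp (a h + y h))
  have hQ : ∀ h, ENNReal.ofReal (Real.exp (a h + -y h)) ≤ Q :=
    le_iSup fun h => ENNReal.ofReal (Real.exp (a h + -y h))
  have h1 : (⨆ h, ENNReal.ofReal (Real.exp (a h + |y h|))) ≤ max P Q := by
    refine iSup_le fun h => ?_
    rcases abs_choice (y h) with e | e <;> rw [e]
    · exact (hP h).trans (le_max_left _ _)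
    · exact (hQ h).trans (le_max_right _ _)
  have h2 : (⨆ h, ENNReal.ofReal (Real.exp (a h - |y h|))) ≤ min P Q := by
    refine iSup_le fun h => le_min ?_ ?_
    · refine (ENNReal.ofReal_le_ofReal (Real.exp_le_exp.2 ?_)).trans (hP h)
      linarith [neg_abs_le (y h)]
    · refine (ENNReal.ofReal_le_ofReal (Real.exp_le_exp.2 ?_)).trans (hQ h)
      linarith [le_abs_self (y h)]
  exact (add_le_add h1 h2).trans (max_add_min P Q).le

/-- Symmetrization and contraction for a single sample. -/
lemma lintegral_iSup_exp_sub_abs_le [Countable ι] [IsProbabilityMeasure ρ] {x : ι → 𝓧 → ℝ}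
    (hx : ∀ h, Measurable (x h)) (hint : ∀ h, Integrable (x h) ρ) {τ : 𝓧 → 𝓧}
    (hτ : MeasurePreserving τ ρ ρ) (hsymm : ∀ h X, x h (τ X) = -x h X) (a : ι → ℝ) :
    ∫⁻ X, ⨆ h, ENNReal.ofReal (Real.exp (a h + (∫ Y, |x h Y| ∂ρ - |x h X|))) ∂ρ ≤
      ∫⁻ X, ⨆ h, ENNReal.ofReal (Real.exp (a h + 2 * x h X)) ∂ρ := by
  let U : 𝓧 → ℝ≥0∞ := fun X => ⨆ h, ENNReal.ofReal (Real.exp (a h + |2 * x h X|))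
  let V : 𝓧 → ℝ≥0∞ := fun X => ⨆ h, ENNReal.ofReal (Real.exp (a h - |2 * x h X|))
  let P : 𝓧 → ℝ≥0∞ := fun X => ⨆ h, ENNReal.ofReal (Real.exp (a h + 2 * x h X))
  let Q : 𝓧 → ℝ≥0∞ := fun X => ⨆ h, ENNReal.ofReal (Real.exp (a h + -(2 * x h X)))
  have hP : Measurable P := by
    refine Measurable.iSup fun h => ?_
    have := hx h
    fun_prop
  have hU : Measurable U := by
    refine Measurable.iSup fun h => ?_
    have := hx h
    fun_prop
  have hPQ : ∫⁻ X, Q X ∂ρ = ∫⁻ X, P X ∂ρ := by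
    rw [← hτ.lintegral_comp hP]
    refine lintegral_congr fun X => ?_
    simp only [P, Q, hsymm, mul_neg]
  have half : ∀ u v : ℝ, ENNReal.ofReal (Real.exp ((u + v) / 2)) ≤
      2⁻¹ * (ENNReal.ofReal (Real.exp u) + ENNReal.ofReal (Real.exp v)) := by
    intro u v
    rw [← ENNReal.ofReal_add (Real.exp_pos _).le (Real.exp_pos _).le,
      show (2 : ℝ≥0∞)⁻¹ = ENNReal.ofReal 2⁻¹ by
        rw [ENNReal.ofReal_inv_of_pos two_pos, ENNReal.ofReal_ofNat],
      ← ENNReal.ofReal_mul (by norm_num)]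
    refine ENNReal.ofReal_le_ofReal ?_
    have h1 : Real.exp ((u + v) / 2) = Real.exp (u / 2) * Real.exp (v / 2) := by
      rw [← Real.exp_add]; ring_nf
    have h2 : Real.exp u = Real.exp (u / 2) ^ 2 := by
      rw [← Real.exp_nat_mul]; ring_nf
    have h3 : Real.exp v = Real.exp (v / 2) ^ 2 := by
      rw [← Real.exp_nat_mul]; ring_nf
    rw [h1, h2, h3]
    nlinarith [sq_nonneg (Real.exp (u / 2) - Real.exp (v / 2))]
  -- Jensen replaces the mean by an independent copy `Y`. Midpoint convexity of `exp` then separates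
  -- `X` from `Y` at the price of doubling both terms, which is the source of the factor `2` in the
  -- conclusion.
  have jensen : ∀ X, (⨆ h, ENNReal.ofReal (Real.exp (a h + (∫ Y, |x h Y| ∂ρ - |x h X|)))) ≤
      2⁻¹ * (∫⁻ Y, U Y ∂ρ + V X) := by
    intro X
    refine iSup_le fun h => ?_
    have e1 : a h + (∫ Y, |x h Y| ∂ρ - |x h X|) = (a h - |x h X|) + ∫ Y, |x h Y| ∂ρ := by ring
    rw [e1]
    refine (ofReal_exp_integral_le (hint h).abs _).trans ?_
    calc _ ≤ ∫⁻ Y, 2⁻¹ * (U Y + V X) ∂ρ := by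
          refine lintegral_mono fun Y => ?_
          have e2 : a h - |x h X| + |x h Y| = ((a h + |2 * x h Y|) + (a h - |2 * x h X|)) / 2 := by
            rw [abs_mul, abs_mul, abs_two]; ring
          rw [e2]
          refine (half _ _).trans ?_
          gcongr
          · exact le_iSup (fun h => ENNReal.ofReal (Real.exp (a h + |2 * x h Y|))) h
          · exact le_iSup (fun h => ENNReal.ofReal (Real.exp (a h - |2 * x h X|))) h
      _ = _ := by
          rw [lintegral_const_mul _ (hU.add_const _), lintegral_add_right _ measurable_const]
          simp
  calc _ ≤ ∫⁻ X, 2⁻¹ * (∫⁻ Y, U Y ∂ρ + V X) ∂ρ := lintegral_mono jensen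
    _ = 2⁻¹ * ∫⁻ X, (U X + V X) ∂ρ := by
        rw [lintegral_const_mul' _ _ (by simp), lintegral_add_left measurable_const,
          lintegral_add_left hU]
        simp
    _ ≤ 2⁻¹ * ∫⁻ X, (P X + Q X) ∂ρ := by
        exact mul_le_mul' le_rfl
          (lintegral_mono fun X => iSup_exp_abs_add_le a fun h => 2 * x h X)
    _ = ∫⁻ X, P X ∂ρ := by
        rw [lintegral_add_left hP, hPQ, ← two_mul, ← mul_assoc,
          ENNReal.inv_mul_cancel two_ne_zero ENNReal.ofNat_ne_top, one_mul]

/-- Comparison of exponential suprema passes from one sample to independent samples. -/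
lemma lintegral_pi_iSup_exp_sum_le [Countable ι] [IsProbabilityMeasure ρ] {f k : ι → 𝓧 → ℝ}
    (hf : ∀ h, Measurable (f h)) (hk : ∀ h, Measurable (k h))
    (hfk : ∀ a : ι → ℝ, ∫⁻ X, ⨆ h, ENNReal.ofReal (Real.exp (a h + f h X)) ∂ρ ≤
      ∫⁻ X, ⨆ h, ENNReal.ofReal (Real.exp (a h + k h X)) ∂ρ) (n : ℕ) (a : ι → ℝ) :
    ∫⁻ X, ⨆ h, ENNReal.ofReal (Real.exp (a h + ∑ i, f h (X i))) ∂(Measure.pi fun _ : Fin n => ρ) ≤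
      ∫⁻ X, ⨆ h, ENNReal.ofReal (Real.exp (a h + ∑ i, k h (X i)))
        ∂(Measure.pi fun _ : Fin n => ρ) := by
  induction n generalizing a with
  | zero => simp
  | succ n ih =>
    have split : ∀ {g : ι → 𝓧 → ℝ}, (∀ h, Measurable (g h)) →
        ∫⁻ X, ⨆ h, ENNReal.ofReal (Real.exp (a h + ∑ i, g h (X i)))
          ∂(Measure.pi fun _ : Fin (n + 1) => ρ) =
        ∫⁻ q, ⨆ h, ENNReal.ofReal (Real.exp (a h + (g h q.1 + ∑ i, g h (q.2 i))))
          ∂(ρ.prod (Measure.pi fun _ : Fin n => ρ)) := by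
      intro g hg
      have hm : Measurable fun q : 𝓧 × (Fin n → 𝓧) =>
          ⨆ h, ENNReal.ofReal (Real.exp (a h + (g h q.1 + ∑ i, g h (q.2 i)))) := by
        refine Measurable.iSup fun h => ?_
        have := hg h
        fun_prop
      rw [← (measurePreserving_piFinSuccAbove (fun _ : Fin (n + 1) => ρ) 0).lintegral_comp hm]
      refine lintegral_congr fun X => ?_
      simp only [Fin.sum_univ_succ]
      rfl
    have meas : ∀ {g g' : ι → 𝓧 → ℝ}, (∀ h, Measurable (g h)) → (∀ h, Measurable (g' h)) →
        Measurable fun q : 𝓧 × (Fin n → 𝓧) =>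
          ⨆ h, ENNReal.ofReal (Real.exp (a h + (g h q.1 + ∑ i, g' h (q.2 i)))) := by
      intro g g' hg hg'
      refine Measurable.iSup fun h => ?_
      have := hg h
      have := hg' h
      fun_prop
    rw [split hf, split hk]
    -- Samples are exchanged one at a time while the others are frozen into the offset `a`; this is
    -- why the one-sample hypothesis is needed for every `a`.
    calc _ = ∫⁻ x, ∫⁻ X, ⨆ h, ENNReal.ofReal (Real.exp (a h + (f h x + ∑ i, f h (X i))))
            ∂(Measure.pi fun _ : Fin n => ρ) ∂ρ := lintegral_prod _ (meas hf hf).aemeasurable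
      _ ≤ ∫⁻ x, ∫⁻ X, ⨆ h, ENNReal.ofReal (Real.exp (a h + (f h x + ∑ i, k h (X i))))
            ∂(Measure.pi fun _ : Fin n => ρ) ∂ρ := by
          refine lintegral_mono fun x => ?_
          simp only [← add_assoc]
          exact ih fun h => a h + f h x
      _ = ∫⁻ X, ∫⁻ x, ⨆ h, ENNReal.ofReal (Real.exp (a h + (f h x + ∑ i, k h (X i)))) ∂ρ
            ∂(Measure.pi fun _ : Fin n => ρ) :=
          lintegral_lintegral_swap (meas hf hk).aemeasurable
      _ ≤ ∫⁻ X, ∫⁻ x, ⨆ h, ENNReal.ofReal (Real.exp (a h + (k h x + ∑ i, k h (X i)))) ∂ρ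
            ∂(Measure.pi fun _ : Fin n => ρ) := by
          refine lintegral_mono fun X => ?_
          have e : ∀ {g : ι → 𝓧 → ℝ} (h : ι) (x : 𝓧), a h + (g h x + ∑ i, k h (X i)) =
            (a h + ∑ i, k h (X i)) + g h x := fun h x => by ring
          simp only [e]
          exact hfk fun h => a h + ∑ i, k h (X i)
      _ = _ := by
          rw [lintegral_prod _ (meas hk hk).aemeasurable]
          exact (lintegral_lintegral_swap (meas hk hk).aemeasurable).symm

end Symmetrization

/-! ### The uniform lower bound for `‖𝒳(H)‖₁` on the cone. -/

section LowerBound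

open scoped ENNReal

variable {n p₁ p₂ : ℕ}

lemma measurable_bilinear (M : Matrix (Fin p₁) (Fin p₂) ℝ) :
    Measurable fun X : (Fin p₁ → ℝ) × (Fin p₂ → ℝ) => X.1 ⬝ᵥ (M *ᵥ X.2) := by
  unfold dotProduct Matrix.mulVec dotProduct; fun_prop

lemma integrable_bilinear (M : Matrix (Fin p₁) (Fin p₂) ℝ) :
    Integrable (fun X => X.1 ⬝ᵥ (M *ᵥ X.2)) (samplePair p₁ p₂) := by
  have h : (fun X : (Fin p₁ → ℝ) × (Fin p₂ → ℝ) => X.1 ⬝ᵥ (M *ᵥ X.2)) =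
      fun X => ∑ j, X.1 j * (M j ⬝ᵥ X.2) := rfl
  rw [h]
  refine integrable_finsetSum _ fun j _ => ?_
  have h1 : Integrable (fun x : Fin p₁ → ℝ => x j) (stdPi p₁) := by
    simpa using integrable_dotProduct_stdPi (Pi.single j (1 : ℝ))
  exact h1.mul_prod (integrable_dotProduct_stdPi (M j))

/-- Averaging over `β` gives `√(2/π) ‖M γ‖`. Cauchy–Schwarz against the vector of row norms `‖M_j‖`
bounds `‖M‖_F ‖M γ‖` below by `∑ ‖M_j‖ |M_j · γ|`, and averaging over `γ` gives a second factor
`√(2/π)`. -/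
lemma frobSq_mul_le_integral_abs_bilinear (M : Matrix (Fin p₁) (Fin p₂) ℝ) :
    2 / Real.pi * frobSq M ≤
      √(frobSq M) * ∫ X, |X.1 ⬝ᵥ (M *ᵥ X.2)| ∂(samplePair p₁ p₂) := by
  have hint := (integrable_bilinear M).abs
  have e1 : ∀ y : Fin p₂ → ℝ, ∫ x, |x ⬝ᵥ (M *ᵥ y)| ∂(stdPi p₁) =
      √(2 / Real.pi) * √((M *ᵥ y) ⬝ᵥ (M *ᵥ y)) := fun y => by
    simp only [dotProduct_comm _ (M *ᵥ y)]
    exact integral_abs_dotProduct_stdPi _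
  have e2 : ∫ X, |X.1 ⬝ᵥ (M *ᵥ X.2)| ∂(samplePair p₁ p₂) =
      ∫ y, √(2 / Real.pi) * √((M *ᵥ y) ⬝ᵥ (M *ᵥ y)) ∂(stdPi p₂) := by
    rw [integral_prod_symm _ hint]
    simp only [e1]
  have hint2 : Integrable (fun y => √(2 / Real.pi) * √((M *ᵥ y) ⬝ᵥ (M *ᵥ y))) (stdPi p₂) := by
    have := hint.integral_prod_right
    simpa only [e1] using this
  have cs : ∀ y : Fin p₂ → ℝ, ∑ j, √(M j ⬝ᵥ M j) * |M j ⬝ᵥ y| ≤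
      √(frobSq M) * √((M *ᵥ y) ⬝ᵥ (M *ᵥ y)) := by
    intro y
    have h0 : ∀ j, 0 ≤ M j ⬝ᵥ M j := fun j => Finset.sum_nonneg fun _ _ => mul_self_nonneg _
    refine (Real.sum_mul_le_sqrt_mul_sqrt Finset.univ _ _).trans (le_of_eq ?_)
    congr 2
    · simp only [Real.sq_sqrt (h0 _)]
      simp only [frobSq, dotProduct, sq]
    · simp only [sq_abs]
      simp only [dotProduct, Matrix.mulVec, sq]
  have e3 : ∫ y, ∑ j, √(M j ⬝ᵥ M j) * |M j ⬝ᵥ y| ∂(stdPi p₂) = √(2 / Real.pi) * frobSq M := by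
    rw [integral_finsetSum _ fun j _ => ((integrable_dotProduct_stdPi (M j)).abs).const_mul _,
      frobSq, Finset.mul_sum]
    refine Finset.sum_congr rfl fun j _ => ?_
    have h0 : 0 ≤ M j ⬝ᵥ M j := Finset.sum_nonneg fun _ _ => mul_self_nonneg _
    rw [integral_const_mul, integral_abs_dotProduct_stdPi, mul_left_comm, Real.mul_self_sqrt h0]
    simp [dotProduct, sq]
  have hs : √(2 / Real.pi) * √(2 / Real.pi) = 2 / Real.pi :=
    Real.mul_self_sqrt (by positivity)
  calc 2 / Real.pi * frobSq M
      = √(2 / Real.pi) * ∫ y, ∑ j, √(M j ⬝ᵥ M j) * |M j ⬝ᵥ y| ∂(stdPi p₂) := by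
        rw [e3, ← mul_assoc, hs]
    _ = ∫ y, √(2 / Real.pi) * ∑ j, √(M j ⬝ᵥ M j) * |M j ⬝ᵥ y| ∂(stdPi p₂) := by
        rw [integral_const_mul]
    _ ≤ ∫ y, √(frobSq M) * (√(2 / Real.pi) * √((M *ᵥ y) ⬝ᵥ (M *ᵥ y))) ∂(stdPi p₂) := by
        refine integral_mono ?_ (hint2.const_mul _) fun y => ?_
        · exact (integrable_finsetSum _ fun j _ =>
            ((integrable_dotProduct_stdPi (M j)).abs).const_mul _).const_mul _
        · change √(2 / Real.pi) * _ ≤ √(frobSq M) * (√(2 / Real.pi) * _)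
          rw [mul_left_comm √(frobSq M)]
          exact mul_le_mul_of_nonneg_left (cs y) (Real.sqrt_nonneg _)
    _ = _ := by rw [integral_const_mul, e2]

lemma third_le_integral_abs_bilinear {M : Matrix (Fin p₁) (Fin p₂) ℝ} (hM : frobSq M = 1) :
    1 / 3 ≤ ∫ X, |X.1 ⬝ᵥ (M *ᵥ X.2)| ∂(samplePair p₁ p₂) := by
  have h := frobSq_mul_le_integral_abs_bilinear M
  rw [hM, Real.sqrt_one, one_mul, mul_one] at h
  refine le_trans ?_ h
  rw [div_le_div_iff₀ (by norm_num) Real.pi_pos]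
  linarith [Real.pi_le_four]

/-- Square root of `1 / (1 - y) = 1 + y / (1 - y) ≤ exp (y / (1 - y))`. -/
lemma inv_sqrt_one_sub_le_exp {y : ℝ} (hy : y < 1) :
    (√(1 - y))⁻¹ ≤ Real.exp (y / (2 * (1 - y))) := by
  have h1 : 0 < 1 - y := by linarith
  have h2 : (1 - y)⁻¹ ≤ Real.exp (y / (1 - y)) := by
    refine le_trans (le_of_eq ?_) (Real.add_one_le_exp _)
    field_simp
    ring
  have h3 : Real.exp (y / (2 * (1 - y))) = √(Real.exp (y / (1 - y))) := by
    rw [eq_comm, Real.sqrt_eq_iff_mul_self_eq (Real.exp_pos _).le (Real.exp_pos _).le,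
      ← Real.exp_add]
    congr 1
    field_simp
    ring
  rw [h3, ← Real.sqrt_inv]
  exact Real.sqrt_le_sqrt h2

/-- The matrices of unit Frobenius norm and of nuclear norm at most `κ`. -/
def nuclearSphere (p₁ p₂ : ℕ) (κ : ℝ) : Set (Matrix (Fin p₁) (Fin p₂) ℝ) :=
  {H | frobSq H = 1 ∧ nuclearNorm H ≤ κ}

/-- Continuity extends the bound from a dense subset to the whole sphere, homogeneity to the cone. A
countable dense subset keeps the suprema measurable. -/
lemma lower_bound_of_dense {b : Fin n → Fin p₁ → ℝ} {g : Fin n → Fin p₂ → ℝ} {κ c : ℝ}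
    {s : Set (nuclearSphere p₁ p₂ κ)} (hs : Dense s)
    (hc : ∀ H : s, c ≤ ∑ i, |ropMap b g H.1.1 i|) (H : Matrix (Fin p₁) (Fin p₂) ℝ)
    (hH : nuclearNorm H ≤ κ * √(frobSq H)) : c * √(frobSq H) ≤ ∑ i, |ropMap b g H i| := by
  have hcont : Continuous fun H : Matrix (Fin p₁) (Fin p₂) ℝ => ropMap b g H :=
    LinearMap.continuous_of_finiteDimensional _
  have hcl : IsClosed {H : nuclearSphere p₁ p₂ κ | c ≤ ∑ i, |ropMap b g H.1 i|} := by
    refine isClosed_le continuous_const (continuous_finsetSum _ fun i _ => ?_)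
    exact (((continuous_apply i).comp hcont).comp continuous_subtype_val).abs
  have hall : ∀ K : nuclearSphere p₁ p₂ κ, c ≤ ∑ i, |ropMap b g K.1 i| := fun K =>
    closure_minimal (fun K hK => hc ⟨K, hK⟩) hcl (hs K)
  rcases (Real.sqrt_nonneg (frobSq H)).eq_or_lt with h0 | h0
  · rw [← h0, mul_zero]
    exact Finset.sum_nonneg fun _ _ => abs_nonneg _
  · set F := √(frobSq H) with hF
    have hFsq : F ^ 2 = frobSq H := Real.sq_sqrt (frobSq_nonneg H)
    have hmem : F⁻¹ • H ∈ nuclearSphere p₁ p₂ κ := by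
      refine ⟨?_, ?_⟩
      · rw [frobSq_smul, ← hFsq, inv_pow]
        exact inv_mul_cancel₀ (by positivity)
      · refine (nuclearNorm_smul_le (by positivity) H).trans ?_
        rw [inv_mul_le_iff₀ h0]
        linarith
    have h1 : c ≤ ∑ i, |ropMap b g (F⁻¹ • H) i| := hall ⟨F⁻¹ • H, hmem⟩
    have h2 : ∑ i, |ropMap b g (F⁻¹ • H) i| = F⁻¹ * ∑ i, |ropMap b g H i| := by
      rw [Finset.mul_sum]
      refine Finset.sum_congr rfl fun i _ => ?_
      rw [map_smul, Pi.smul_apply, smul_eq_mul, abs_mul, abs_of_pos (inv_pos.2 h0)]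
    rw [h2, ← div_eq_inv_mul, le_div_iff₀ h0] at h1
    exact h1

/-- With high probability, the `ℓ₁` norm of the measurements of a Gaussian design dominates the
Frobenius norm on the nuclear norm cone. -/
lemma sampleLaw_lower_bound_fails_le {r : ℕ} (hr : 0 < r)
    (hn : 82944 * r * ((p₁ : ℝ) + p₂) ≤ n) :
    sampleLaw n p₁ p₂ {X | ¬ ∀ H : Matrix (Fin p₁) (Fin p₂) ℝ,
      nuclearNorm H ≤ 3 * √r * √(frobSq H) →
      n / 6 * √(frobSq H) ≤ ∑ i, |ropMap (fun i => (X i).1) (fun i => (X i).2) H i|} ≤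
      ENNReal.ofReal (2 * Real.exp (-((p₁ : ℝ) + p₂))) := by
  have : SecondCountableTopology (Matrix (Fin p₁) (Fin p₂) ℝ) :=
    inferInstanceAs (SecondCountableTopology (Fin p₁ → Fin p₂ → ℝ))
  have hr' : (1 : ℝ) ≤ r := by exact_mod_cast hr
  obtain ⟨s, hsc, hsd⟩ := TopologicalSpace.exists_countable_dense (nuclearSphere p₁ p₂ (3 * √r))
  have : Countable s := hsc.to_subtype
  -- This `l` maximizes `l / 6 - 144 l² r`: the deviation `1/3 - 1/6` per sample against the
  -- exponent `(2 t)² = 144 l² r` of the moment bound. The maximum is `l / 12`.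
  set l : ℝ := 1 / (1728 * r) with hl
  have hl0 : 0 < l := by positivity
  let x : s → ((Fin p₁ → ℝ) × (Fin p₂ → ℝ)) → ℝ := fun H X => l * (X.1 ⬝ᵥ (H.1.1 *ᵥ X.2))
  have hx : ∀ H, Measurable (x H) := fun H => (measurable_bilinear H.1.1).const_mul _
  have hxint : ∀ H, Integrable (x H) (samplePair p₁ p₂) := fun H =>
    (integrable_bilinear H.1.1).const_mul _
  let τ : ((Fin p₁ → ℝ) × (Fin p₂ → ℝ)) → ((Fin p₁ → ℝ) × (Fin p₂ → ℝ)) :=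
    Prod.map (fun x => fun j => -x j) id
  have hτ : MeasurePreserving τ (samplePair p₁ p₂) (samplePair p₁ p₂) := by
    refine MeasurePreserving.prod ?_ (MeasurePreserving.id _)
    refine measurePreserving_pi _ _ fun _ => ⟨measurable_neg, ?_⟩
    simpa using gaussianReal_map_neg (μ := 0) (v := 1)
  have hsymm : ∀ H X, x H (τ X) = -x H X := by
    intro H X
    have : (fun j => -X.1 j) = -X.1 := rfl
    simp only [x, τ, Prod.map_fst, Prod.map_snd, id, this, neg_dotProduct, mul_neg]
  have hmain := lintegral_pi_iSup_exp_sum_le (ρ := samplePair p₁ p₂)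
    (f := fun H X => ∫ Y, |x H Y| ∂(samplePair p₁ p₂) - |x H X|) (k := fun H X => 2 * x H X)
    (fun H => measurable_const.sub (hx H).abs) (fun H => (hx H).const_mul _)
    (lintegral_iSup_exp_sub_abs_le hx hxint hτ hsymm) n (fun _ => 0)
  simp only [zero_add] at hmain
  -- The factor `2 l` of the symmetrized process times the nuclear-norm bound `3 √r`.
  set t : ℝ := 6 * l * √r with ht
  have ht0 : 0 ≤ t := by positivity
  have hupper : ∫⁻ X, ⨆ H, ENNReal.ofReal (Real.exp (∑ i, 2 * x H (X i))) ∂(sampleLaw n p₁ p₂) ≤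
      ∫⁻ X, ENNReal.ofReal (Real.exp (t * spectralNorm
        (ropDual (fun i => (X i).1) (fun i => (X i).2) fun _ => (1 : ℝ)))) ∂(sampleLaw n p₁ p₂) := by
    refine lintegral_mono fun X => iSup_le fun H =>
      ENNReal.ofReal_le_ofReal (Real.exp_le_exp.2 ?_)
    have e : ∑ i, 2 * x H (X i) = 2 * l * frobInner
        (ropDual (fun i => (X i).1) (fun i => (X i).2) fun _ => (1 : ℝ)) H.1.1 := by
      rw [frobInner_ropDual, Finset.mul_sum]
      refine Finset.sum_congr rfl fun i _ => ?_
      simp only [x, ropMap, LinearMap.coe_mk, AddHom.coe_mk]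
      ring
    rw [e]
    have h1 := (frobInner_le (ropDual (fun i => (X i).1) (fun i => (X i).2) fun _ => (1 : ℝ))
      H.1.1).trans (mul_le_mul_of_nonneg_left H.1.2.2 (spectralNorm_nonneg _))
    refine (mul_le_mul_of_nonneg_left h1 (by positivity : 0 ≤ 2 * l)).trans (le_of_eq ?_)
    rw [ht]; ring
  have hty : (2 * t * 1) ^ 2 = 144 * l ^ 2 * r := by
    rw [ht, mul_one, mul_pow, mul_pow, mul_pow, Real.sq_sqrt (by positivity)]; ring
  have hlr : l * r = 1 / 1728 := by rw [hl]; field_simp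
  have hl1 : l ≤ 1 / 1728 := by
    rw [← hlr]; exact le_mul_of_one_le_right hl0.le hr'
  have hy2 : 144 * l ^ 2 * r = l / 12 := by
    calc 144 * l ^ 2 * r = 144 * l * (l * r) := by ring
      _ = _ := by rw [hlr]; ring
  have hexp := lintegral_exp_spectralNorm_ropDual_le (n := n) (p₁ := p₁) (p₂ := p₂) ht0
    (w := fun _ => 1) (fun _ => by rw [hty, hy2]; linarith)
  simp only [hty, hy2, Finset.prod_const, Finset.card_univ, Fintype.card_fin] at hexp
  have hfac : (√(1 - l / 12))⁻¹ ≤ Real.exp (l / 12) := by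
    refine (inv_sqrt_one_sub_le_exp (by linarith)).trans (Real.exp_le_exp.2 ?_)
    exact div_le_self (by positivity) (by linarith)
  -- If some `H` in the dense set has `∑ |𝒳(H)| < n / 6`, its sum lies at least `n / 6` below its
  -- mean, which is at least `n / 3`.
  have hbad : {X | ¬ ∀ H : Matrix (Fin p₁) (Fin p₂) ℝ,
      nuclearNorm H ≤ 3 * √r * √(frobSq H) →
      n / 6 * √(frobSq H) ≤ ∑ i, |ropMap (fun i => (X i).1) (fun i => (X i).2) H i|} ⊆
      {X : Fin n → (Fin p₁ → ℝ) × (Fin p₂ → ℝ) | ENNReal.ofReal (Real.exp (l * n / 6)) ≤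
        ⨆ H, ENNReal.ofReal (Real.exp
          (∑ i, (∫ Y, |x H Y| ∂(samplePair p₁ p₂) - |x H (X i)|)))} := by
    intro X hX
    by_contra hcon
    refine hX ?_
    have good : ∀ H : s, n / 6 ≤
        ∑ i, |ropMap (fun i => (X i).1) (fun i => (X i).2) H.1.1 i| := by
      intro H
      by_contra! hlt
      refine hcon (le_trans (ENNReal.ofReal_le_ofReal (Real.exp_le_exp.2 ?_))
        (le_iSup (fun H => ENNReal.ofReal (Real.exp
          (∑ i, (∫ Y, |x H Y| ∂(samplePair p₁ p₂) - |x H (X i)|)))) H))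
      have e1 : ∫ Y, |x H Y| ∂(samplePair p₁ p₂) =
          l * ∫ Y, |Y.1 ⬝ᵥ (H.1.1 *ᵥ Y.2)| ∂(samplePair p₁ p₂) := by
        simp only [x, abs_mul, abs_of_pos hl0]
        rw [integral_const_mul]
      have e2 : ∑ i, |x H (X i)| =
          l * ∑ i, |ropMap (fun i => (X i).1) (fun i => (X i).2) H.1.1 i| := by
        rw [Finset.mul_sum]
        refine Finset.sum_congr rfl fun i _ => ?_
        simp only [x, abs_mul, abs_of_pos hl0, ropMap, LinearMap.coe_mk, AddHom.coe_mk]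
      rw [Finset.sum_sub_distrib, e2, e1]
      simp only [Finset.sum_const, Finset.card_univ, Fintype.card_fin, nsmul_eq_mul]
      have h3 := third_le_integral_abs_bilinear H.1.2.1
      have h4 : (n : ℝ) * (l * (1 / 3)) ≤
          n * (l * ∫ Y, |Y.1 ⬝ᵥ (H.1.1 *ᵥ Y.2)| ∂(samplePair p₁ p₂)) := by gcongr
      have h5 := mul_le_mul_of_nonneg_left hlt.le hl0.le
      linarith
    exact lower_bound_of_dense hsd good
  have hmeas : Measurable fun X : Fin n → (Fin p₁ → ℝ) × (Fin p₂ → ℝ) =>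
      ⨆ H, ENNReal.ofReal (Real.exp
        (∑ i, (∫ Y, |x H Y| ∂(samplePair p₁ p₂) - |x H (X i)|))) := by
    refine Measurable.iSup fun H => ?_
    have := hx H
    fun_prop
  refine (measure_mono hbad).trans ?_
  refine (meas_ge_le_lintegral_div hmeas.aemeasurable
    (by simpa using Real.exp_pos _) ENNReal.ofReal_ne_top).trans ?_
  refine ENNReal.div_le_of_le_mul ?_
  refine (hmain.trans (hupper.trans hexp)).trans ?_
  rw [← ENNReal.ofReal_mul (by positivity)]
  have e1 : (2 * 9 ^ (p₁ + p₂) * ENNReal.ofReal (√(1 - l / 12))⁻¹ ^ n : ℝ≥0∞) =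
      ENNReal.ofReal (2 * 9 ^ (p₁ + p₂) * ((√(1 - l / 12))⁻¹) ^ n) := by
    rw [ENNReal.ofReal_mul (by positivity), ENNReal.ofReal_mul (by positivity),
      ENNReal.ofReal_pow (by positivity), ENNReal.ofReal_pow (by positivity)]
    simp
  rw [e1]
  refine ENNReal.ofReal_le_ofReal ?_
  have h9 : (9 : ℝ) ^ (p₁ + p₂) ≤ Real.exp (3 * ((p₁ : ℝ) + p₂)) := by
    have h9' : (9 : ℝ) ≤ Real.exp 3 := by
      have h1 : Real.exp 3 = Real.exp 1 ^ 3 := by rw [← Real.exp_nat_mul]; norm_num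
      rw [h1]
      have := Real.exp_one_gt_d9
      calc (9 : ℝ) ≤ 2.7 ^ 3 := by norm_num
        _ ≤ _ := by gcongr; linarith
    have h2 : Real.exp (3 * ((p₁ : ℝ) + p₂)) = Real.exp 3 ^ (p₁ + p₂) := by
      rw [← Real.exp_nat_mul]; push_cast; ring_nf
    rw [h2]
    gcongr
  have hpow : ((√(1 - l / 12))⁻¹) ^ n ≤ Real.exp (n * (l / 12)) := by
    rw [Real.exp_nat_mul]
    exact pow_le_pow_left₀ (by positivity) hfac n
  -- The nets cost an exponent `3 (p₁ + p₂)` and the claim needs one more `p₁ + p₂`. The requirement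
  -- `l n / 12 ≥ 4 (p₁ + p₂)` gives `82944 = 48 · 1728`.
  have hln : 4 * ((p₁ : ℝ) + p₂) ≤ l * n / 12 := by
    have h1 := mul_le_mul_of_nonneg_left hn hl0.le
    have h2 : l * (82944 * r * ((p₁ : ℝ) + p₂)) = 48 * ((p₁ : ℝ) + p₂) := by
      calc _ = 82944 * (l * r) * ((p₁ : ℝ) + p₂) := by ring
        _ = _ := by rw [hlr]; ring
    rw [h2] at h1
    linarith
  calc 2 * 9 ^ (p₁ + p₂) * ((√(1 - l / 12))⁻¹) ^ n
      ≤ 2 * Real.exp (3 * ((p₁ : ℝ) + p₂)) * Real.exp (n * (l / 12)) := by gcongr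
    _ = 2 * Real.exp (3 * ((p₁ : ℝ) + p₂) + n * (l / 12)) := by rw [Real.exp_add]; ring
    _ ≤ 2 * Real.exp (-((p₁ : ℝ) + p₂) + l * n / 6) := by
        refine mul_le_mul_of_nonneg_left (Real.exp_le_exp.2 ?_) two_pos.le
        linarith
    _ = _ := by rw [Real.exp_add]; ring

end LowerBound

/-! ### Good noise vectors and the spectral norm for fixed noise. -/

section Noise

open scoped ENNReal

variable {n p₁ p₂ : ℕ}

lemma measure_gaussianReal_abs_gt_le {a : ℝ} (ha : 0 ≤ a) :
    gaussianReal 0 1 {x | a < |x|} ≤ ENNReal.ofReal (2 * Real.exp (-(a ^ 2 / 2))) := by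
  have hm : Measurable fun x : ℝ => ENNReal.ofReal (Real.exp (a * x)) +
      ENNReal.ofReal (Real.exp (-a * x)) := by fun_prop
  have hsub : {x : ℝ | a < |x|} ⊆ {x | ENNReal.ofReal (Real.exp (a ^ 2)) ≤
      ENNReal.ofReal (Real.exp (a * x)) + ENNReal.ofReal (Real.exp (-a * x))} := by
    intro x hx
    have hx' : a < |x| := hx
    rcases abs_cases x with ⟨hq, -⟩ | ⟨hq, -⟩
    · refine le_trans (ENNReal.ofReal_le_ofReal (Real.exp_le_exp.2 ?_)) le_self_add
      rw [hq] at hx'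
      nlinarith
    · refine le_trans (ENNReal.ofReal_le_ofReal (Real.exp_le_exp.2 ?_)) le_add_self
      rw [hq] at hx'
      nlinarith
  refine (measure_mono hsub).trans ((meas_ge_le_lintegral_div hm.aemeasurable
    (by simpa using Real.exp_pos _) ENNReal.ofReal_ne_top).trans ?_)
  refine ENNReal.div_le_of_le_mul ?_
  rw [lintegral_add_left (by fun_prop), lintegral_exp_mul_gaussianReal,
    lintegral_exp_mul_gaussianReal, neg_sq, ← ENNReal.ofReal_add (Real.exp_pos _).le
    (Real.exp_pos _).le, ← ENNReal.ofReal_mul (by positivity)]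
  refine ENNReal.ofReal_le_ofReal (le_of_eq ?_)
  rw [mul_assoc, ← Real.exp_add, ← two_mul]
  congr 2
  ring

/-- Chebyshev with mean `c n` and variance `(1 - c²) n`, where `c = √(2/π)`. The resulting constant
`(1 + c) / (1 - c)` is below `9.15`. -/
lemma stdPi_sum_abs_gt_le (hn : 0 < n) :
    stdPi n {w | (n : ℝ) < ∑ i, |w i|} ≤ ENNReal.ofReal (9.15 / n) := by
  have hn' : (0 : ℝ) < n := by exact_mod_cast hn
  set c := √(2 / Real.pi) with hc
  have hc0 : 0 ≤ c := Real.sqrt_nonneg _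
  have hc1 : c ≤ 0.802 := by
    refine Real.sqrt_le_iff.2 ⟨by norm_num, ?_⟩
    rw [div_le_iff₀ Real.pi_pos]
    linarith [Real.pi_gt_d2]
  have hmem1 : MemLp (fun x : ℝ => |x|) 2 (gaussianReal 0 1) :=
    (memLp_id_gaussianReal' 2 (by simp)).abs
  have hvar1 : Var[fun x : ℝ => |x|; gaussianReal 0 1] = 1 - c ^ 2 := by
    rw [variance_eq_sub hmem1, integral_abs_gaussianReal]
    congr 1
    have h2 := variance_fun_id_gaussianReal (μ := 0) (v := 1)
    rw [variance_eq_sub (X := fun x : ℝ => x) (memLp_id_gaussianReal' 2 (by simp)),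
      integral_id_gaussianReal] at h2
    simpa using h2
  let Y : (Fin n → ℝ) → ℝ := ∑ i, fun w : Fin n → ℝ => |w i|
  have hYapp : ∀ w, Y w = ∑ i, |w i| := fun w => by simp [Y]
  have hvar : Var[Y; stdPi n] = n * (1 - c ^ 2) := by
    rw [variance_sum_pi (X := fun _ : Fin n => fun x : ℝ => |x|) fun _ => hmem1]
    simp only [hvar1, Finset.sum_const, Finset.card_univ, Fintype.card_fin, nsmul_eq_mul]
  have hcomp : ∀ i : Fin n, MemLp (fun w : Fin n → ℝ => |w i|) 2 (stdPi n) := fun i =>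
    hmem1.comp_measurePreserving (measurePreserving_eval (fun _ : Fin n => gaussianReal 0 1) i)
  have hYmem : MemLp Y 2 (stdPi n) := memLp_finsetSum' _ fun i _ => hcomp i
  have hmean : ∫ w, Y w ∂(stdPi n) = n * c := by
    simp only [hYapp]
    rw [integral_finsetSum _ fun i _ => (hcomp i).integrable (by norm_num)]
    have : ∀ i : Fin n, ∫ w : Fin n → ℝ, |w i| ∂(stdPi n) = c := fun i => by
      rw [hc, ← integral_abs_gaussianReal]
      have hp := measurePreserving_eval (fun _ : Fin n => gaussianReal 0 1) i
      rw [← hp.map_eq, integral_map hp.measurable.aemeasurable (by fun_prop)]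
    simp [this]
  have hgap : 0 < n * (1 - c) := mul_pos hn' (by linarith)
  have hcheb := meas_ge_le_variance_div_sq hYmem hgap
  refine (measure_mono ?_).trans (hcheb.trans (ENNReal.ofReal_le_ofReal ?_))
  · intro w hw
    have hw' : (n : ℝ) < ∑ i, |w i| := hw
    change n * (1 - c) ≤ |Y w - ∫ w, Y w ∂(stdPi n)|
    rw [hmean, hYapp]
    refine le_trans ?_ (le_abs_self _)
    linarith
  · rw [hvar, div_le_div_iff₀ (by positivity) hn']
    have h1 : (1 - c ^ 2) ≤ 9.15 * (1 - c) ^ 2 := by nlinarith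
    nlinarith [mul_le_mul_of_nonneg_left h1 (by positivity : (0 : ℝ) ≤ n * n)]

/-- Chernoff with parameter `1/4`: the bound `(√2 · exp (-0.6)) ^ n ≤ 0.8 ^ n` is at most `1 / n`
from `n = 12` on. -/
lemma stdPi_sum_sq_gt_le (hn : 12 ≤ n) :
    stdPi n {w | 2.4 * (n : ℝ) < ∑ i, w i ^ 2} ≤ ENNReal.ofReal (1 / n) := by
  have hn' : (0 : ℝ) < n := by exact_mod_cast (by omega : 0 < n)
  have hint : ∫⁻ w, ∏ i, ENNReal.ofReal (Real.exp (1 / 4 * w i ^ 2)) ∂(stdPi n) =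
      ENNReal.ofReal (√2 ^ n) := by
    rw [lintegral_pi_prod (gaussianReal 0 1)
      (f := fun _ x => ENNReal.ofReal (Real.exp (1 / 4 * x ^ 2))) fun _ => by fun_prop]
    rw [lintegral_exp_mul_sq_gaussianReal (by norm_num)]
    rw [Finset.prod_const, ← ENNReal.ofReal_pow (by positivity), ← Real.sqrt_inv]
    norm_num
  have hm : Measurable fun w : Fin n → ℝ => ∏ i, ENNReal.ofReal (Real.exp (1 / 4 * w i ^ 2)) := by
    fun_prop
  have hsub : {w : Fin n → ℝ | 2.4 * (n : ℝ) < ∑ i, w i ^ 2} ⊆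
      {w | ENNReal.ofReal (Real.exp (n * 0.6)) ≤
        ∏ i, ENNReal.ofReal (Real.exp (1 / 4 * w i ^ 2))} := by
    intro w hw
    have hw' : 2.4 * (n : ℝ) < ∑ i, w i ^ 2 := hw
    rw [Set.mem_ofPred_eq, ← ENNReal.ofReal_prod_of_nonneg fun _ _ => (Real.exp_pos _).le, ← Real.exp_sum,
      ← Finset.mul_sum]
    refine ENNReal.ofReal_le_ofReal (Real.exp_le_exp.2 ?_)
    linarith
  refine (measure_mono hsub).trans ((meas_ge_le_lintegral_div hm.aemeasurable
    (by simpa using Real.exp_pos _) ENNReal.ofReal_ne_top).trans ?_)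
  refine ENNReal.div_le_of_le_mul ?_
  rw [hint, ← ENNReal.ofReal_mul (by positivity)]
  refine ENNReal.ofReal_le_ofReal ?_
  have h2 : √2 ≤ 1.4143 := Real.sqrt_le_iff.2 ⟨by norm_num, by norm_num⟩
  have he : 1.78 ≤ Real.exp 0.6 := by
    have := Real.quadratic_le_exp_of_nonneg (by norm_num : (0 : ℝ) ≤ 0.6)
    norm_num at this ⊢
    linarith
  have hstep : √2 ≤ 0.8 * Real.exp 0.6 := by nlinarith
  have hnum : ∀ m : ℕ, 12 ≤ m → (m : ℝ) * 0.8 ^ m ≤ 1 := by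
    intro m hm
    induction m, hm using Nat.le_induction with
    | base => norm_num
    | succ k hk ih =>
      have hk' : (12 : ℝ) ≤ k := by exact_mod_cast hk
      have : ((k + 1 : ℕ) : ℝ) * 0.8 ^ (k + 1) = (0.8 * (k + 1)) * 0.8 ^ k := by
        push_cast; ring
      rw [this]
      refine le_trans (mul_le_mul_of_nonneg_right ?_ (by positivity)) ih
      linarith
  have h8 : (0.8 : ℝ) ^ n ≤ 1 / n := by
    rw [le_div_iff₀ hn', mul_comm]
    exact hnum n hn
  calc √2 ^ n ≤ (0.8 * Real.exp 0.6) ^ n := pow_le_pow_left₀ (by positivity) hstep n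
    _ = 0.8 ^ n * Real.exp (n * 0.6) := by rw [mul_pow, Real.exp_nat_mul]
    _ ≤ _ := mul_le_mul_of_nonneg_right h8 (Real.exp_pos _).le

/-- A union bound gives `2 n · n ^ (-2.4) = 2 n ^ (-0.4) / n`, and `n ^ 0.4 ≥ 2.5` for `n ≥ 12`. -/
lemma stdPi_exists_sq_gt_le (hn : 12 ≤ n) :
    stdPi n {w | ∃ i, 4.8 * Real.log n < w i ^ 2} ≤ ENNReal.ofReal (0.8 / n) := by
  have hn' : (0 : ℝ) < n := by exact_mod_cast (by omega : 0 < n)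
  have hlog : 0 ≤ Real.log n := Real.log_natCast_nonneg n
  have hone : ∀ i : Fin n, stdPi n {w | 4.8 * Real.log n < w i ^ 2} ≤
      ENNReal.ofReal (2 * Real.exp (-(2.4 * Real.log n))) := by
    intro i
    have hp := measurePreserving_eval (fun _ : Fin n => gaussianReal 0 1) i
    have hset : MeasurableSet {x : ℝ | √(4.8 * Real.log n) < |x|} :=
      measurableSet_lt measurable_const (by fun_prop)
    have h1 := measure_gaussianReal_abs_gt_le (Real.sqrt_nonneg (4.8 * Real.log n))
    rw [Real.sq_sqrt (by positivity)] at h1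
    rw [← hp.measure_preimage hset.nullMeasurableSet] at h1
    refine (measure_mono ?_).trans (h1.trans (le_of_eq ?_))
    · intro w hw
      have hw' : 4.8 * Real.log n < w i ^ 2 := hw
      change √(4.8 * Real.log n) < |w i|
      rw [← Real.sqrt_sq_eq_abs]
      exact Real.sqrt_lt_sqrt (by positivity) hw'
    · congr 4
      ring
  rw [Set.ofPred_exists]
  refine (measure_iUnion_le _).trans ?_
  rw [tsum_fintype]
  refine (Finset.sum_le_sum fun i _ => hone i).trans ?_
  rw [Finset.sum_const, Finset.card_univ, Fintype.card_fin, nsmul_eq_mul,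
    ← ENNReal.ofReal_natCast, ← ENNReal.ofReal_mul (by positivity)]
  refine ENNReal.ofReal_le_ofReal ?_
  set L := Real.log n with hL
  have hexp : Real.exp L = n := Real.exp_log hn'
  have h25 : 2.5 ≤ Real.exp (0.4 * L) := by
    have h5 : Real.exp (0.4 * L) ^ 5 = (n : ℝ) ^ 2 := by
      rw [← hexp, ← Real.exp_nat_mul, ← Real.exp_nat_mul]
      congr 1
      push_cast
      ring
    have h12 : (12 : ℝ) ≤ n := by exact_mod_cast hn
    refine (pow_le_pow_iff_left₀ (by norm_num) (Real.exp_pos _).le (by norm_num : 5 ≠ 0)).1 ?_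
    rw [h5]
    norm_num
    nlinarith
  have hsplit : Real.exp (-(2.4 * L)) = (Real.exp (0.4 * L))⁻¹ * ((n : ℝ) * n)⁻¹ := by
    rw [← hexp, ← Real.exp_add, ← Real.exp_neg, ← Real.exp_neg, ← Real.exp_add]
    congr 1
    ring
  rw [hsplit]
  have hinv : (Real.exp (0.4 * L))⁻¹ ≤ 0.4 := by
    rw [inv_le_comm₀ (Real.exp_pos _) (by norm_num)]
    norm_num at h25 ⊢
    exact h25
  calc (n : ℝ) * (2 * ((Real.exp (0.4 * L))⁻¹ * ((n : ℝ) * n)⁻¹))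
      = 2 * (Real.exp (0.4 * L))⁻¹ / n := by field_simp
    _ ≤ 0.8 / n := by
        refine div_le_div_of_nonneg_right ?_ hn'.le
        linarith

/-- The standardized noise vectors on which all the estimates hold. -/
def goodNoise (n : ℕ) : Set (Fin n → ℝ) :=
  {w | ∑ i, |w i| ≤ n ∧ ∑ i, w i ^ 2 ≤ 2.4 * n ∧ ∀ i, w i ^ 2 ≤ 4.8 * Real.log n}

lemma measurableSet_goodNoise : MeasurableSet (goodNoise n) := by
  have h1 : MeasurableSet {w : Fin n → ℝ | ∑ i, |w i| ≤ n} :=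
    measurableSet_le (by fun_prop) measurable_const
  have h2 : MeasurableSet {w : Fin n → ℝ | ∑ i, w i ^ 2 ≤ 2.4 * n} :=
    measurableSet_le (by fun_prop) measurable_const
  refine h1.inter (h2.inter ?_)
  have h3 : {w : Fin n → ℝ | ∀ i, w i ^ 2 ≤ 4.8 * Real.log n} =
      ⋂ i, {w : Fin n → ℝ | w i ^ 2 ≤ 4.8 * Real.log n} := by
    ext; simp
  change MeasurableSet {w : Fin n → ℝ | ∀ i, w i ^ 2 ≤ 4.8 * Real.log n}
  rw [h3]
  exact MeasurableSet.iInter fun i => measurableSet_le (by fun_prop) measurable_const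

lemma stdPi_compl_goodNoise_le (hn : 12 ≤ n) :
    stdPi n (goodNoise n)ᶜ ≤ ENNReal.ofReal (11 / n) := by
  have hn' : (0 : ℝ) < n := by exact_mod_cast (by omega : 0 < n)
  have hsub : (goodNoise n)ᶜ ⊆ {w : Fin n → ℝ | (n : ℝ) < ∑ i, |w i|} ∪
      ({w | 2.4 * (n : ℝ) < ∑ i, w i ^ 2} ∪ {w | ∃ i, 4.8 * Real.log n < w i ^ 2}) := by
    intro w hw
    by_contra hcon
    simp only [Set.mem_union, Set.mem_ofPred_eq, not_or, not_lt, not_exists] at hcon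
    exact hw hcon
  refine (measure_mono hsub).trans ((measure_union_le _ _).trans
    ((add_le_add (stdPi_sum_abs_gt_le (by omega)) ((measure_union_le _ _).trans
      (add_le_add (stdPi_sum_sq_gt_le hn) (stdPi_exists_sq_gt_le hn)))).trans ?_))
  -- The failure budget is `9.15 + 1 + 0.8 ≤ 11`.
  rw [← ENNReal.ofReal_add (by positivity) (by positivity),
    ← ENNReal.ofReal_add (by positivity) (by positivity), ← add_div, ← add_div]
  refine ENNReal.ofReal_le_ofReal (div_le_div_of_nonneg_right (by norm_num) hn'.le)

lemma nine_pow_le_exp (p : ℕ) : (9 : ℝ) ^ p ≤ Real.exp (2.2 * p) := by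
  have h9 : (9 : ℝ) ≤ Real.exp 2.2 := by
    refine (pow_le_pow_iff_left₀ (by norm_num) (Real.exp_pos _).le (by norm_num : 5 ≠ 0)).1 ?_
    have h1 : Real.exp 2.2 ^ 5 = Real.exp 1 ^ 11 := by
      rw [← Real.exp_nat_mul, ← Real.exp_nat_mul]
      congr 1
      norm_num
    rw [h1]
    calc (9 : ℝ) ^ 5 ≤ 2.7182818283 ^ 11 := by norm_num
      _ ≤ _ := pow_le_pow_left₀ (by norm_num) Real.exp_one_gt_d9.le 11
  rw [mul_comm, Real.exp_nat_mul]
  exact pow_le_pow_left₀ (by norm_num) h9 p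

lemma continuous_spectralNorm_ropDual (w : Fin n → ℝ) :
    Continuous fun X : Fin n → (Fin p₁ → ℝ) × (Fin p₂ → ℝ) =>
      spectralNorm (ropDual (fun i => (X i).1) (fun i => (X i).2) w) := by
  refine continuous_spectralNorm.comp ?_
  unfold ropDual
  fun_prop

/-- The Chernoff parameter adapted to the level `eta`. -/
lemma exists_chernoff_parameter (hn : 2 ≤ n) {p : ℝ} (hp' : 0 < p) {w : Fin n → ℝ}
    (hw : w ∈ goodNoise n) :
    ∃ t : ℝ, 0 < t ∧ t * (12 * √(Real.log n) * p + 6 * √(2 * n * p)) = 2.7 * p ∧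
      (∀ i, (2 * t * w i) ^ 2 < 1) ∧
      ∏ i, (√(1 - (2 * t * w i) ^ 2))⁻¹ ≤ Real.exp (0.486 * p) := by
  obtain ⟨-, hw2, hw3⟩ := hw
  have hn' : (0 : ℝ) < n := by exact_mod_cast (by omega : 0 < n)
  set L := Real.log n with hL
  have hL0 : 0 < L := Real.log_pos (by exact_mod_cast (by omega : 1 < n))
  set a := √L with ha
  have ha0 : 0 < a := Real.sqrt_pos.2 hL0
  have ha2 : a ^ 2 = L := Real.sq_sqrt hL0.le
  set e := √(2 * n / p) with he
  have he0 : 0 < e := Real.sqrt_pos.2 (by positivity)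
  have he2 : e ^ 2 = 2 * n / p := Real.sq_sqrt (by positivity)
  -- With this `d`, the level for `σ = 1` factors as `6 p d`, so `t = 0.45 / d` makes the Chernoff
  -- exponent exactly `2.7 p`.
  set d := 2 * a + e with hd
  have hd0 : 0 < d := by positivity
  set t := 0.45 / d with ht
  have ht0 : 0 < t := by positivity
  have heta : (12 * √(Real.log n) * p + 6 * √(2 * n * p)) = 6 * p * d := by
    have h1 : √(2 * n * p) = p * e := by
      rw [Real.sqrt_eq_iff_mul_self_eq (by positivity) (by positivity), ← sq, mul_pow, he2]
      field_simp
    rw [h1, hd, ← hL, ← ha]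
    ring
  have hteta : t * (12 * √(Real.log n) * p + 6 * √(2 * n * p)) = 2.7 * p := by
    rw [heta, ht]
    field_simp
    norm_num
  -- The two parts of `d`, normalized to `x + y = 0.9`. The sup bound on `w` is absorbed by `x` and
  -- the `ℓ₂` bound by `y`; since `x ≤ 0.9`, the denominator satisfies `1 - 1.2 x² ≥ 0.028`.
  set x := 1.8 * a / d with hx
  set y := 0.9 * e / d with hy
  have hxy : x + y = 0.9 := by
    rw [hx, hy, hd]
    field_simp
    ring
  have hx0 : 0 ≤ x := by positivity
  have hy0 : 0 ≤ y := by positivity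
  have hx2 : x ^ 2 = 3.24 * L / d ^ 2 := by
    rw [hx, div_pow, mul_pow, ha2]; norm_num
  have hy2 : y ^ 2 = 0.81 * (2 * n / p) / d ^ 2 := by
    rw [hy, div_pow, mul_pow, he2]; norm_num
  have hti : ∀ v : ℝ, (2 * t * v) ^ 2 = 0.81 / d ^ 2 * v ^ 2 := fun v => by
    rw [ht]; field_simp; norm_num; ring
  have hden : 0 < 1 - 1.2 * x ^ 2 := by nlinarith
  have hwi : ∀ i, (2 * t * w i) ^ 2 ≤ 1.2 * x ^ 2 := fun i => by
    rw [hti, hx2]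
    calc 0.81 / d ^ 2 * w i ^ 2 ≤ 0.81 / d ^ 2 * (4.8 * L) := by gcongr; exact hw3 i
      _ = _ := by ring
  have hprod : ∏ i, (√(1 - (2 * t * w i) ^ 2))⁻¹ ≤ Real.exp (0.486 * p) := by
    calc ∏ i, (√(1 - (2 * t * w i) ^ 2))⁻¹
        ≤ ∏ i, Real.exp ((2 * t * w i) ^ 2 / (2 * (1 - 1.2 * x ^ 2))) := by
          refine Finset.prod_le_prod (fun i _ => by positivity) fun i _ => ?_
          refine (inv_sqrt_one_sub_le_exp (by linarith [hwi i])).trans (Real.exp_le_exp.2 ?_)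
          have := hwi i
          gcongr
      _ = Real.exp ((∑ i, (2 * t * w i) ^ 2) / (2 * (1 - 1.2 * x ^ 2))) := by
          rw [← Real.exp_sum, Finset.sum_div]
      _ ≤ Real.exp (0.486 * p) := by
          refine Real.exp_le_exp.2 ?_
          rw [div_le_iff₀ (by positivity)]
          have h1 : ∑ i, (2 * t * w i) ^ 2 ≤ 1.2 * p * y ^ 2 := by
            simp only [hti]
            rw [← Finset.mul_sum, hy2]
            calc 0.81 / d ^ 2 * ∑ i, w i ^ 2 ≤ 0.81 / d ^ 2 * (2.4 * n) := by gcongr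
              _ = _ := by field_simp; norm_num
          refine h1.trans ?_
          have hyx : y = 0.9 - x := by linarith
          -- Equality holds at `x = 0`, which fixes `0.486 = 1.2 · 0.81 / 2`. The difference of the
          -- two sides is `x (2.16 - 2.3664 x)`, nonnegative on `[0, 0.9]`.
          have h2 : 1.2 * y ^ 2 ≤ 0.486 * (2 * (1 - 1.2 * x ^ 2)) := by
            rw [hyx]
            nlinarith
          nlinarith [mul_le_mul_of_nonneg_left h2 hp'.le]
  exact ⟨t, ht0, hteta, fun i => by linarith [hwi i], hprod⟩

/-- For a good noise vector `w`, the spectral norm of `𝒳*(w)` is small with high probability. -/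
lemma sampleLaw_eta_lt_spectralNorm_le (hn : 2 ≤ n) (hp : 0 < p₁ + p₂) {w : Fin n → ℝ}
    (hw : w ∈ goodNoise n) :
    sampleLaw n p₁ p₂ {X | eta n p₁ p₂ 1 <
      spectralNorm (ropDual (fun i => (X i).1) (fun i => (X i).2) w)} ≤
      ENNReal.ofReal (2 * Real.exp (-(0.014 * ((p₁ : ℝ) + p₂)))) := by
  set p : ℝ := (p₁ : ℝ) + p₂ with hpdef
  have hp' : 0 < p := by rw [hpdef]; exact_mod_cast hp
  obtain ⟨t, ht0, hteta, hlt, hprod⟩ := exists_chernoff_parameter hn hp' hw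
  replace hteta : t * eta n p₁ p₂ 1 = 2.7 * p := by
    rw [← hteta, eta, one_mul]
  have hexp := lintegral_exp_spectralNorm_ropDual_le (n := n) (p₁ := p₁) (p₂ := p₂) ht0.le
    (w := w) hlt
  have hcont := continuous_spectralNorm_ropDual (p₁ := p₁) (p₂ := p₂) w
  have hm : Measurable fun X : Fin n → (Fin p₁ → ℝ) × (Fin p₂ → ℝ) => ENNReal.ofReal
      (Real.exp (t * spectralNorm (ropDual (fun i => (X i).1) (fun i => (X i).2) w))) := by
    have := hcont.measurable
    fun_prop
  have hsub : {X : Fin n → (Fin p₁ → ℝ) × (Fin p₂ → ℝ) | eta n p₁ p₂ 1 <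
      spectralNorm (ropDual (fun i => (X i).1) (fun i => (X i).2) w)} ⊆
      {X | ENNReal.ofReal (Real.exp (2.7 * p)) ≤ ENNReal.ofReal (Real.exp
        (t * spectralNorm (ropDual (fun i => (X i).1) (fun i => (X i).2) w)))} := by
    intro X hX
    rw [Set.mem_ofPred_eq] at hX ⊢
    refine ENNReal.ofReal_le_ofReal (Real.exp_le_exp.2 ?_)
    rw [← hteta]
    exact mul_le_mul_of_nonneg_left hX.le ht0.le
  have hexp0 : ENNReal.ofReal (Real.exp (2.7 * p)) ≠ 0 := by
    simpa using Real.exp_pos _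
  refine (measure_mono hsub).trans
    ((meas_ge_le_lintegral_div hm.aemeasurable hexp0 ENNReal.ofReal_ne_top).trans ?_)
  refine ENNReal.div_le_of_le_mul (hexp.trans ?_)
  rw [← ENNReal.ofReal_prod_of_nonneg fun i _ => by positivity,
    ← ENNReal.ofReal_mul (by positivity)]
  have e1 : (2 * 9 ^ (p₁ + p₂) : ℝ≥0∞) = ENNReal.ofReal (2 * 9 ^ (p₁ + p₂)) := by
    rw [ENNReal.ofReal_mul (by positivity), ENNReal.ofReal_pow (by positivity)]
    simp
  rw [e1, ← ENNReal.ofReal_mul (by positivity)]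
  refine ENNReal.ofReal_le_ofReal ?_
  have h9 := nine_pow_le_exp (p₁ + p₂)
  rw [Nat.cast_add, ← hpdef] at h9
  -- The exponents balance as `2.2 + 0.486 - 2.7 = -0.014`.
  calc 2 * 9 ^ (p₁ + p₂) * ∏ i, (√(1 - (2 * t * w i) ^ 2))⁻¹
      ≤ 2 * Real.exp (2.2 * p) * Real.exp (0.486 * p) := by gcongr
    _ = 2 * Real.exp (-(0.014 * p)) * Real.exp (2.7 * p) := by
        rw [mul_assoc, mul_assoc, ← Real.exp_add, ← Real.exp_add]
        congr 2
        ring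

end Noise

/-! ### Transfer to the probability space and combination of the events. -/

section Assembly

open scoped ENNReal

variable {n p₁ p₂ : ℕ}

lemma measurable_spectralNorm_ropDual :
    Measurable fun q : (Fin n → (Fin p₁ → ℝ) × (Fin p₂ → ℝ)) × (Fin n → ℝ) =>
      spectralNorm (ropDual (fun i => (q.1 i).1) (fun i => (q.1 i).2) q.2) := by
  refine (continuous_spectralNorm.comp ?_).measurable
  unfold ropDual
  fun_prop

/-- Design and noise are independent, so Fubini allows the spectral norm bound to be applied with
the noise frozen at a good value. -/
lemma sampleLaw_prod_stdPi_bad_le (hn : 12 ≤ n) (hp : 0 < p₁ + p₂) :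
    (sampleLaw n p₁ p₂).prod (stdPi n) {q | q.2 ∉ goodNoise n ∨ eta n p₁ p₂ 1 <
      spectralNorm (ropDual (fun i => (q.1 i).1) (fun i => (q.1 i).2) q.2)} ≤
    ENNReal.ofReal (11 / n) + ENNReal.ofReal (2 * Real.exp (-(0.014 * ((p₁ : ℝ) + p₂)))) := by
  set T : Set ((Fin n → (Fin p₁ → ℝ) × (Fin p₂ → ℝ)) × (Fin n → ℝ)) :=
    {q | q.2 ∈ goodNoise n} ∩ {q | eta n p₁ p₂ 1 <
      spectralNorm (ropDual (fun i => (q.1 i).1) (fun i => (q.1 i).2) q.2)} with hT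
  have hTm : MeasurableSet T := (measurable_snd measurableSet_goodNoise).inter
    (measurableSet_lt measurable_const measurable_spectralNorm_ropDual)
  have hsub : {q : (Fin n → (Fin p₁ → ℝ) × (Fin p₂ → ℝ)) × (Fin n → ℝ) |
      q.2 ∉ goodNoise n ∨ eta n p₁ p₂ 1 <
      spectralNorm (ropDual (fun i => (q.1 i).1) (fun i => (q.1 i).2) q.2)} ⊆
      (Set.univ ×ˢ (goodNoise n)ᶜ) ∪ T := by
    intro q hq
    by_cases h : q.2 ∈ goodNoise n
    · exact Or.inr ⟨h, hq.resolve_left fun h' => h' h⟩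
    · exact Or.inl ⟨trivial, h⟩
  refine (measure_mono hsub).trans ((measure_union_le _ _).trans (add_le_add ?_ ?_))
  · rw [Measure.prod_prod, measure_univ, one_mul]
    exact stdPi_compl_goodNoise_le hn
  · rw [Measure.prod_apply_symm hTm]
    refine (lintegral_mono (g := fun _ => ENNReal.ofReal
      (2 * Real.exp (-(0.014 * ((p₁ : ℝ) + p₂))))) fun w => ?_).trans (by simp)
    by_cases hw : w ∈ goodNoise n
    · exact (measure_mono fun X hX => hX.2).trans
        (sampleLaw_eta_lt_spectralNorm_le (by omega) hp hw)
    · have : (fun X : Fin n → (Fin p₁ → ℝ) × (Fin p₂ → ℝ) => (X, w)) ⁻¹' T = ∅ := by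
        ext X
        simp [hT, hw]
      simp [this]

lemma spectralNorm_smul_of_nonneg {σ : ℝ} (hσ : 0 ≤ σ) (M : Matrix (Fin p₁) (Fin p₂) ℝ) :
    spectralNorm (σ • M) = σ * spectralNorm M := by
  simp [spectralNorm, norm_smul, abs_of_nonneg hσ]

/-- Both constraints are homogeneous in `σ`, which reduces feasibility to standard noise, including
`σ = 0`. -/
lemma smul_mem_constraint {σ : ℝ} (hn : 0 < n) (hσ : 0 ≤ σ) {b : Fin n → Fin p₁ → ℝ}
    {g : Fin n → Fin p₂ → ℝ} {w : Fin n → ℝ} (hw : ∑ i, |w i| ≤ n)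
    (hs : spectralNorm (ropDual b g w) ≤ eta n p₁ p₂ 1) :
    σ • w ∈ constraintL1 n σ ∩ constraintDantzig b g σ := by
  have hn' : (0 : ℝ) < n := by exact_mod_cast hn
  constructor
  · change (∑ i, |(σ • w) i|) / n ≤ σ
    rw [div_le_iff₀ hn']
    simp only [Pi.smul_apply, smul_eq_mul, abs_mul, abs_of_nonneg hσ, ← Finset.mul_sum]
    exact mul_le_mul_of_nonneg_left hw hσ
  · change spectralNorm (ropDual b g (σ • w)) ≤ eta n p₁ p₂ σ
    rw [ropDual_smul, spectralNorm_smul_of_nonneg hσ]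
    refine (mul_le_mul_of_nonneg_left hs hσ).trans_eq ?_
    simp [eta]

/-- The law of i.i.d. noise with standard deviation `σ`. -/
abbrev noiseLaw (n : ℕ) (σ : ℝ) : Measure (Fin n → ℝ) :=
  Measure.pi fun _ => gaussianReal 0 (Real.toNNReal (σ ^ 2))

lemma measurePreserving_smul_stdPi (n : ℕ) (σ : ℝ) :
    MeasurePreserving (fun w : Fin n → ℝ => σ • w) (stdPi n) (noiseLaw n σ) := by
  refine measurePreserving_pi (f := fun _ x => σ * x) _ _ fun _ => ⟨by fun_prop, ?_⟩
  rw [gaussianReal_map_const_mul]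
  congr 1
  · simp
  · ext
    simp [Real.coe_toNNReal _ (sq_nonneg σ)]

lemma measurableSet_constraint (σ : ℝ) : MeasurableSet
    {q : (Fin n → (Fin p₁ → ℝ) × (Fin p₂ → ℝ)) × (Fin n → ℝ) | q.2 ∉ constraintL1 n σ ∩
      constraintDantzig (fun i => (q.1 i).1) (fun i => (q.1 i).2) σ} := by
  have h1 : MeasurableSet {q : (Fin n → (Fin p₁ → ℝ) × (Fin p₂ → ℝ)) × (Fin n → ℝ) |
      (∑ i, |q.2 i|) / n ≤ σ} := measurableSet_le (by fun_prop) measurable_const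
  have h2 : MeasurableSet {q : (Fin n → (Fin p₁ → ℝ) × (Fin p₂ → ℝ)) × (Fin n → ℝ) |
      spectralNorm (ropDual (fun i => (q.1 i).1) (fun i => (q.1 i).2) q.2) ≤ eta n p₁ p₂ σ} :=
    measurableSet_le measurable_spectralNorm_ropDual measurable_const
  exact (h1.inter h2).compl

lemma sampleLaw_prod_noiseLaw_notMem_constraint_le {σ : ℝ} (hn : 12 ≤ n) (hp : 0 < p₁ + p₂)
    (hσ : 0 ≤ σ) :
    (sampleLaw n p₁ p₂).prod (noiseLaw n σ) {q | q.2 ∉ constraintL1 n σ ∩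
      constraintDantzig (fun i => (q.1 i).1) (fun i => (q.1 i).2) σ} ≤
    ENNReal.ofReal (11 / n) + ENNReal.ofReal (2 * Real.exp (-(0.014 * ((p₁ : ℝ) + p₂)))) := by
  rw [← ((MeasurePreserving.id (sampleLaw n p₁ p₂)).prod
    (measurePreserving_smul_stdPi n σ)).measure_preimage
      (measurableSet_constraint σ).nullMeasurableSet]
  refine (measure_mono fun q hq => ?_).trans (sampleLaw_prod_stdPi_bad_le hn hp)
  by_contra hcon
  have hcon' : q.2 ∈ goodNoise n ∧ spectralNorm (ropDual (fun i => (q.1 i).1)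
      (fun i => (q.1 i).2) q.2) ≤ eta n p₁ p₂ 1 := by
    simpa only [Set.mem_ofPred_eq, not_or, not_not, not_lt] using hcon
  exact hq (smul_mem_constraint (by omega) hσ hcon'.1.1 hcon'.2)

lemma measurePreserving_curry_pi (n p : ℕ) :
    MeasurePreserving (MeasurableEquiv.curry (Fin n) (Fin p) ℝ)
      (Measure.pi fun _ : Fin n × Fin p => gaussianReal 0 1)
      (Measure.pi fun _ : Fin n => stdPi p) := by
  refine ⟨(MeasurableEquiv.curry (Fin n) (Fin p) ℝ).measurable, ?_⟩
  have h := Measure.infinitePi_map_curry (fun (_ : Fin n) (_ : Fin p) => gaussianReal 0 1)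
  simpa only [Measure.infinitePi_eq_pi] using h

section Law

variable {Ω : Type*} [MeasurableSpace Ω] {μ : Measure Ω}
  {β : Ω → Fin n → Fin p₁ → ℝ} {γ : Ω → Fin n → Fin p₂ → ℝ} {z : Ω → Fin n → ℝ} {σ : ℝ}

lemma IsROPDesign.hasLaw_samples (h : IsROPDesign μ (gaussianReal 0 1) β γ) :
    HasLaw (fun ω i => (β ω i, γ ω i)) (sampleLaw n p₁ p₂) μ := by
  have h1 := iIndepFun.hasLaw_pi h.hasLaw h.iIndep
  have h2 := (measurePreserving_sumPiEquivProdPi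
    (fun _ : (Fin n × Fin p₁) ⊕ (Fin n × Fin p₂) => gaussianReal 0 1)).comp_hasLaw h1
  have h3 := ((measurePreserving_curry_pi n p₁).prod
    (measurePreserving_curry_pi n p₂)).comp_hasLaw h2
  exact (measurePreserving_arrowProdEquivProdArrow (Fin p₁ → ℝ) (Fin p₂ → ℝ) (Fin n)
    (fun _ => stdPi p₁) (fun _ => stdPi p₂)).symm.comp_hasLaw h3

lemma IsGaussianNoise.hasLaw_noise (h : IsGaussianNoise μ σ z) : HasLaw z (noiseLaw n σ) μ :=
  iIndepFun.hasLaw_pi h.hasLaw h.iIndep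

lemma hasLaw_samples_prod_noise [IsProbabilityMeasure μ]
    (hX : IsROPDesign μ (gaussianReal 0 1) β γ) (hz : IsGaussianNoise μ σ z)
    (hind : IndepFun (fun ω => (β ω, γ ω)) z μ) :
    HasLaw (fun ω => ((fun i => (β ω i, γ ω i)), z ω))
      ((sampleLaw n p₁ p₂).prod (noiseLaw n σ)) μ := by
  refine (indepFun_iff_hasLaw_prodMk_prod hX.hasLaw_samples hz.hasLaw_noise).1 ?_
  exact hind.comp (MeasurableEquiv.arrowProdEquivProdArrow (Fin p₁ → ℝ) (Fin p₂ → ℝ)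
    (Fin n)).symm.measurable measurable_id

end Law

/-- For `r = 0` the cone contains only the zero matrix, so the bound never fails. -/
lemma sampleLaw_lower_bound_fails_le_of_le {r : ℕ} (hn : 82944 * r * ((p₁ : ℝ) + p₂) ≤ n) :
    sampleLaw n p₁ p₂ {X | ¬ ∀ H : Matrix (Fin p₁) (Fin p₂) ℝ,
      nuclearNorm H ≤ 3 * √r * √(frobSq H) →
      n / 6 * √(frobSq H) ≤ ∑ i, |ropMap (fun i => (X i).1) (fun i => (X i).2) H i|} ≤
    ENNReal.ofReal (2 * Real.exp (-((p₁ : ℝ) + p₂))) := by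
  rcases Nat.eq_zero_or_pos r with rfl | hr
  · refine le_of_eq_of_le (measure_mono_null (t := ∅) (fun X hX => hX fun H hH => ?_)
      measure_empty) zero_le
    have h0 : √(frobSq H) = 0 := le_antisymm
      ((sqrt_frobSq_le_nuclearNorm H).trans (by simpa using hH)) (Real.sqrt_nonneg _)
    rw [h0, mul_zero]
    exact Finset.sum_nonneg fun _ _ => abs_nonneg _
  · exact sampleLaw_lower_bound_fails_le hr hn

/-- Stated for arbitrary `S` because the failure set of the lower bound involves uncountably many
`H`; an inequality of outer measures suffices. -/
lemma measure_preimage_le_of_hasLaw {Ω 𝓧 : Type*} [MeasurableSpace Ω] [MeasurableSpace 𝓧]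
    {μ : Measure Ω} {ν : Measure 𝓧} {X : Ω → 𝓧} (hX : HasLaw X ν μ) (S : Set 𝓧) :
    μ (X ⁻¹' S) ≤ ν S :=
  (Measure.le_map_apply hX.aemeasurable S).trans_eq (by rw [hX.map_eq])

/-- Lowering the rate from `0.014` to `0.001` gains a factor `exp (0.013 p) ≥ 4/3`, which reduces
the prefactor from `4` to `3`. -/
lemma two_exp_add_two_exp_le {p : ℝ} (hp : 100 ≤ p) :
    2 * Real.exp (-(0.014 * p)) + 2 * Real.exp (-p) ≤ 3 * Real.exp (-0.001 * p) := by
  have h1 : Real.exp (-p) ≤ Real.exp (-(0.014 * p)) := Real.exp_le_exp.2 (by linarith)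
  have h2 : Real.exp (-0.001 * p) = Real.exp (0.013 * p) * Real.exp (-(0.014 * p)) := by
    rw [← Real.exp_add]
    ring_nf
  have h3 : 4 / 3 ≤ Real.exp (0.013 * p) := by
    linarith [Real.add_one_le_exp (0.013 * p)]
  have h4 := mul_le_mul_of_nonneg_right h3 (Real.exp_pos (-(0.014 * p))).le
  linarith

lemma measureReal_compl_toMeasurable_ge {Ω : Type*} [MeasurableSpace Ω] {μ : Measure Ω}
    [IsProbabilityMeasure μ] {B : Set Ω} {ε : ℝ} (hε : 0 ≤ ε) (hB : μ B ≤ ENNReal.ofReal ε) :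
    1 - ε ≤ μ.real (toMeasurable μ B)ᶜ := by
  rw [probReal_compl_eq_one_sub (measurableSet_toMeasurable μ B)]
  have h : μ.real (toMeasurable μ B) ≤ ε := by
    rw [Measure.real, measure_toMeasurable]
    exact ENNReal.toReal_le_of_le_ofReal hε hB
  linarith

end Assembly

end ROP

end


open ROP in
theorem theorem2p3 :
    ∃ C W δ : ℝ, 0 < C ∧ 0 < W ∧ 0 < δ ∧
      ∀ (n p₁ p₂ r : ℕ) (σ : ℝ), 0 < n → 0 ≤ σ →
        C * r * ((p₁ : ℝ) + p₂) ≤ n →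
      ∀ (Ω : Type*) [MeasurableSpace Ω] (μ : Measure Ω) [IsProbabilityMeasure μ]
        (β : Ω → Fin n → Fin p₁ → ℝ) (γ : Ω → Fin n → Fin p₂ → ℝ) (z : Ω → Fin n → ℝ),
        ROP.IsROPDesign μ (gaussianReal 0 1) β γ →
        ROP.IsGaussianNoise μ σ z →
        -- the noise is independent of the design
        IndepFun (fun ω => (β ω, γ ω)) z μ →
        -- one event serves all the matrices `A` of rank at most `r`
        ∃ E : Set Ω, MeasurableSet E ∧
          1 - 11 / (n : ℝ) - 3 * Real.exp (-δ * ((p₁ : ℝ) + p₂)) ≤ μ.real E ∧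
          ∀ ω ∈ E, ∀ A : Matrix (Fin p₁) (Fin p₂) ℝ, A.rank ≤ r →
            (∃ Ahat, ROP.IsEstimate (β ω) (γ ω) σ (ROP.ropMap (β ω) (γ ω) A + z ω) Ahat) ∧
            ∀ Ahat, ROP.IsEstimate (β ω) (γ ω) σ (ROP.ropMap (β ω) (γ ω) A + z ω) Ahat →
              ROP.frobSq (Ahat - A) ≤
                W * σ ^ 2 * min
                  (r * Real.log n * ((p₁ : ℝ) + p₂) ^ 2 / (n : ℝ) ^ 2
                    + r * ((p₁ : ℝ) + p₂) / n) 1 := by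
  refine ⟨82944, 216 ^ 2 * 288, 0.001, by norm_num, by norm_num, by norm_num, ?_⟩
  intro n p₁ p₂ r σ hn hσ hC Ω _ μ _ β γ z hX hz hind
  have hn' : (0 : ℝ) < n := by exact_mod_cast hn
  -- For `n ≤ 11` the promised probability is not positive, so the empty event works.
  rcases Nat.lt_or_ge n 12 with hn12 | hn12
  · refine ⟨∅, MeasurableSet.empty, ?_, by simp⟩
    have h1 : (1 : ℝ) ≤ 11 / n := by
      rw [one_le_div hn']
      exact_mod_cast Nat.le_of_lt_succ hn12
    have h2 := Real.exp_pos (-0.001 * ((p₁ : ℝ) + p₂))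
    simp only [measureReal_empty]
    linarith
  -- Likewise vacuous: here `3 exp (-0.001 (p₁ + p₂)) ≥ 2.7`.
  rcases Nat.lt_or_ge (p₁ + p₂) 100 with hp100 | hp100
  · refine ⟨∅, MeasurableSet.empty, ?_, by simp⟩
    have h1 : (p₁ : ℝ) + p₂ ≤ 100 := by exact_mod_cast hp100.le
    have h2 := Real.add_one_le_exp (-0.001 * ((p₁ : ℝ) + p₂))
    have h3 : (0 : ℝ) ≤ 11 / n := by positivity
    simp only [measureReal_empty]
    linarith
  have hp : (100 : ℝ) ≤ (p₁ : ℝ) + p₂ := by exact_mod_cast hp100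
  set B₁ : Set Ω := {ω | z ω ∉ constraintL1 n σ ∩ constraintDantzig (β ω) (γ ω) σ}
  set B₂ : Set Ω := {ω | ¬ ∀ H : Matrix (Fin p₁) (Fin p₂) ℝ,
    nuclearNorm H ≤ 3 * √r * √(frobSq H) →
    n / 6 * √(frobSq H) ≤ ∑ i, |ropMap (β ω) (γ ω) H i|}
  have h₁ : μ B₁ ≤ _ :=
    (measure_preimage_le_of_hasLaw (hasLaw_samples_prod_noise hX hz hind) _).trans
      (sampleLaw_prod_noiseLaw_notMem_constraint_le hn12 (by omega) hσ)
  have h₂ : μ B₂ ≤ _ := (measure_preimage_le_of_hasLaw hX.hasLaw_samples _).trans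
    (sampleLaw_lower_bound_fails_le_of_le hC)
  have hexp := two_exp_add_two_exp_le hp
  have hB : μ (B₁ ∪ B₂) ≤ ENNReal.ofReal
      (11 / n + 3 * Real.exp (-0.001 * ((p₁ : ℝ) + p₂))) := by
    refine (measure_union_le _ _).trans ((add_le_add h₁ h₂).trans ?_)
    rw [← ENNReal.ofReal_add (by positivity) (by positivity),
      ← ENNReal.ofReal_add (by positivity) (by positivity)]
    exact ENNReal.ofReal_le_ofReal (by linarith)
  -- The complement of a measurable hull avoids having to prove the bad set measurable.
  refine ⟨(toMeasurable μ (B₁ ∪ B₂))ᶜ, (measurableSet_toMeasurable _ _).compl, ?_, ?_⟩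
  · have := measureReal_compl_toMeasurable_ge (by positivity) hB
    linarith
  · intro ω hω A hA
    have hω' : ω ∉ B₁ ∪ B₂ := fun h => hω (subset_toMeasurable μ _ h)
    have hnoise : z ω ∈ constraintL1 n σ ∩ constraintDantzig (β ω) (γ ω) σ :=
      not_not.1 fun h => hω' (Or.inl h)
    have hlow := not_not.1 fun h => hω' (Or.inr h)
    exact ⟨exists_isEstimate ⟨A, mem_feasible_of_noise_mem hnoise⟩,
      fun Ahat hest => frobSq_sub_le_of_isEstimate hn hσ hnoise hlow hA hest⟩
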